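/- For an integer $m\ge 1$ let $[m]=\{1,\dots,m\}$, let $\mathfrak S_m$ be the set of permutations of $[m]$, and let $\mathfrak S_m^1=\{\theta\in\mathfrak S_m:\theta(1)=1\}$. For $j\in\mathbb Z$ let $\langle j\rangle_m$ be the element of $[m]$ congruent to $j$ modulo $m$. Let $\mathcal V_m$ be the set of all $\theta\in\mathfrak S_m$ such that $$\theta(i+1)-\theta(i)\equiv\theta(1)-\mathbf 1(\theta(m)\le\theta(i)) \pmod m\qquad\text{for all } i\in[m-1],$$ where $\mathbf 1(P)$ is $1$ if $P$ is true and $0$ otherwise (so $\mathcal V_1=\mathfrak S_1$). For $m\ge2$ let $\Gamma_m:\mathfrak S_m\to\mathfrak S_m^1$, $\Gamma_m(\theta)(i)=\langle\theta(i)-\theta(1)+1\rangle_m$, and let $\Psi_m:\mathfrak S_m^1\to\mathfrak S_{m-1}$, $\Psi_m(\theta)(i)=\theta(i+1)-1$. Let $\theta_{a,b}(i)=\langle ai+b\rangle_m$. **The generation tree $T_M$ of the lifting procedure.** It has levels $1,\dots,M$. The nodes of level $m$ are the elements of $\mathcal V_m$. For $2\le m\le M$, the node $\theta\in\mathcal V_m$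 is a child of $\pi\in\mathcal V_{m-1}$ if and only if $\Psi_m(\Gamma_m(\theta))=\pi$. If $\pi$ has two children, they are $\theta_{a,0}$ and $\theta_{a,1}$ for some $a\in[m]$ with $\gcd(a,m)=1$, and $\theta_{a,0}$ is placed to the left of $\theta_{a,1}$. **The Farey interval tree $T_{F,M}$.** Let $\mathfrak F_m$ be the set of open intervals between two successive terms of the Farey sequence of order $m$ (the fractions in $[0,1]$ with denominator at most $m$), and let $\preceq_{\mathfrak F_m}$ be its order from left to right. The tree has levels $1,\dots,M$. The nodes of level $m$ are the elements of $\mathfrak F_m$. For $2\le m\le M$, the node $F'\in\mathfrak F_m$ is a child of $F\in\mathfrak F_{m-1}$ if and only if $F'\subset F$. Siblings are arranged in the order $\preceq_{\mathfrak F_m}$. **Surányi's bijection and $T_{S,M}$.** For $\theta\in\mathcal V_m$ let $\mathsf F_m[\theta]$ be the set of all $\alpha\in(0,1)$ such that $\sigma=\theta^{-1}$ satisfies $0<\{\sigma(1)\alpha\}<\dots<\{\sigma(m)\alpha\}<1$, where $\{x\}$ is the fractional part of $x$. The map $\mathsf F_m:\mathcal V_m\to\mathfrak F_m$ is a bijection.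 Let $T_{S,M}$ be the tree obtained from $T_{F,M}$ by replacing each node $F\in\mathfrak F_m$ with $\mathsf F_m^{-1}[F]$, for all $m\in[M]$. **Theorem.** For every integer $M\ge1$, $T_M$ and $T_{F,M}$ are rooted binary trees with ordered siblings, and the trees $T_M$ and $T_{S,M}$ are identical, including the horizontal (left-to-right) order of the nodes. In other words, the bijections $\mathsf F_m$ $(m\in[M])$ form an isomorphism of binary trees from $T_M$ onto $T_{F,M}$. In particular, for each $m\in[M]$ and all $\theta,\theta'\in\mathcal V_m$, the node $\theta$ is equal to or to the left of $\theta'$ in level $m$ of $T_M$ if and only if $\mathsf F_m[\theta]\preceq_{\mathfrak F_m}\mathsf F_m[\theta']$. -/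

import Mathlib

namespace SosTree

/-! ### Permutations of `[m] = {1, …, m}`

A permutation of degree `m` is an `Equiv.Perm (Fin m)`; the element `k : Fin m` stands for
`k + 1 ∈ [m]`. -/

/-- The term `θ(i)` in the one-based convention: for `i ∈ [m]` it lies in `[m]`
(and it is `0` for `i ∉ [m]`). -/
def term {m : ℕ} (θ : Equiv.Perm (Fin m)) (i : ℕ) : ℤ :=
  if h : 1 ≤ i ∧ i ≤ m then ((θ ⟨i - 1, by omega⟩ : ℕ) : ℤ) + 1 else 0

/-- The residue of `j` modulo `m` taken in `{1, …, m}`. -/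
def smod (m : ℕ) (j : ℤ) : ℤ := (j - 1) % (m : ℤ) + 1

/-- `𝒱_m`: the permutations with
`θ(i+1) - θ(i) ≡ θ(1) - 𝟙(θ(m) ≤ θ(i)) (mod m)` for all `i ∈ [m-1]`
(for `m = 1` this is all of `𝔖_1`). -/
def V (m : ℕ) : Set (Equiv.Perm (Fin m)) :=
  {θ | ∀ i ∈ Finset.Icc 1 (m - 1),
    term θ (i + 1) - term θ i ≡ term θ 1 - (if term θ m ≤ term θ i then 1 else 0) [ZMOD m]}

/-- `θ = θ_{a,b}`, that is, `θ(i)` is the residue of `a i + b` in `[m]` for all `i ∈ [m]`. -/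
def IsTheta {m : ℕ} (a b : ℤ) (θ : Equiv.Perm (Fin m)) : Prop :=
  ∀ i ∈ Finset.Icc 1 m, term θ i = smod m (a * (i : ℤ) + b)

/-- The shift `Γ`, onto the permutations of degree `m + 1` that fix the first point. In zero-based
values it is `i ↦ θ(i) - θ(first)` modulo `m + 1`; in one-based values
`i ↦` (residue of `θ(i) - θ(1) + 1` in `[m + 1]`). -/
def Gam {m : ℕ} (θ : Equiv.Perm (Fin (m + 1))) : {ρ : Equiv.Perm (Fin (m + 1)) // ρ 0 = 0} :=
  ⟨θ.trans (Equiv.subRight (θ 0)), by simp⟩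

/-- `Ψ`: a permutation of degree `m + 1` fixing the first point is sent to the permutation
`i ↦ θ(i + 1) - 1` of degree `m`. -/
def Psi {m : ℕ} (θ : {ρ : Equiv.Perm (Fin (m + 1)) // ρ 0 = 0}) : Equiv.Perm (Fin m) where
  toFun i := (θ.1 i.succ).pred fun h =>
    Fin.succ_ne_zero i (θ.1.injective (h.trans θ.2.symm))
  invFun i := (θ.1.symm i.succ).pred fun h =>
    Fin.succ_ne_zero i (((Equiv.symm_apply_eq _).1 h).trans θ.2)
  left_inv i := by simp
  right_inv i := by simp

/-- The value of `Γ` in the one-based convention. -/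
theorem term_Gam {m : ℕ} (θ : Equiv.Perm (Fin (m + 1))) (i : ℕ) (hi : i ∈ Finset.Icc 1 (m + 1)) :
    term (Gam θ).1 i = smod (m + 1) (term θ i - term θ 1 + 1) := by
  obtain ⟨h1, h2⟩ := Finset.mem_Icc.1 hi
  have key : ∀ x y : Fin (m + 1),
      (((x - y : Fin (m + 1)) : ℕ) : ℤ) = ((x : ℤ) - (y : ℤ)) % ((m + 1 : ℕ) : ℤ) := by
    intro x y
    rw [Fin.sub_def]
    have := y.isLt
    push_cast [Nat.cast_sub this.le]
    rw [show ((m : ℤ) + 1 - (y : ℕ) + (x : ℕ)) = ((x : ℕ) - (y : ℕ) : ℤ) + (m + 1) by ring,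
      Int.add_emod_right]
  simp only [term, smod, h1, h2, and_self, dite_true, Gam, Equiv.trans_apply,
    Equiv.subRight_apply, le_refl, Nat.le_add_left, key]
  congr 2
  simp

/-- The value of `Ψ` in the one-based convention. -/
theorem term_Psi {m : ℕ} (θ : {ρ : Equiv.Perm (Fin (m + 1)) // ρ 0 = 0}) (i : ℕ)
    (hi : i ∈ Finset.Icc 1 m) : term (Psi θ) i = term θ.1 (i + 1) - 1 := by
  obtain ⟨h1, h2⟩ := Finset.mem_Icc.1 hi
  obtain ⟨k, rfl⟩ := Nat.exists_eq_add_of_le' h1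
  have hk : k < m := by omega
  have hne : θ.1 (Fin.succ ⟨k, hk⟩) ≠ 0 := fun h =>
    Fin.succ_ne_zero _ (θ.1.injective (h.trans θ.2.symm))
  have h3 : 1 ≤ ((θ.1 (Fin.succ ⟨k, hk⟩) : Fin (m + 1)) : ℕ) := by
    exact Nat.one_le_iff_ne_zero.2 fun h => hne (Fin.ext h)
  have e1 : term (Psi θ) (k + 1) = (((θ.1 (Fin.succ ⟨k, hk⟩) : ℕ) - 1 : ℕ) : ℤ) + 1 := by
    simp [term, Psi, hk]
  have e2 : term θ.1 (k + 1 + 1) = ((θ.1 (Fin.succ ⟨k, hk⟩) : ℕ) : ℤ) + 1 := by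
    simp [term, hk]
  rw [e1, e2, Nat.cast_sub h3]
  simp

/-! ### Sós permutations and Farey intervals -/

/-- `0 < {σ(1)α} < {σ(2)α} < ⋯ < {σ(m)α} < 1`. -/
def SosSorts {m : ℕ} (σ : Equiv.Perm (Fin m)) (α : ℝ) : Prop :=
  (∀ i : Fin m, 0 < Int.fract ((((σ i : ℕ) : ℝ) + 1) * α)) ∧
    StrictMono fun i : Fin m => Int.fract ((((σ i : ℕ) : ℝ) + 1) * α)

/-- `τ_α^m = θ`: the inverse of `θ` is the Sós permutation of degree `m` with parameter `α`. -/
def IsTau {m : ℕ} (α : ℝ) (θ : Equiv.Perm (Fin m)) : Prop := SosSorts θ⁻¹ α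

/-- `𝖥_m[θ]`: the set of all `α ∈ (0, 1)` such that `τ_α^m = θ`. -/
def fareyOf (m : ℕ) (θ : Equiv.Perm (Fin m)) : Set ℝ := {α | 0 < α ∧ α < 1 ∧ IsTau α θ}

/-- The terms of the Farey sequence of order `m`. -/
def fareySet (m : ℕ) : Set ℚ := {q | 0 ≤ q ∧ q ≤ 1 ∧ q.den ≤ m}

/-- `a < b` are successive terms of the Farey sequence of order `m`. -/
def FareySucc (m : ℕ) (a b : ℚ) : Prop :=
  a ∈ fareySet m ∧ b ∈ fareySet m ∧ a < b ∧ ∀ c ∈ fareySet m, ¬ (a < c ∧ c < b)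

/-- `𝔉_m`: the open intervals between two successive terms of the Farey sequence of order `m`. -/
def fareyIntervals (m : ℕ) : Set (Set ℝ) :=
  {F | ∃ a b : ℚ, FareySucc m a b ∧ F = Set.Ioo (a : ℝ) (b : ℝ)}

/-- The order of `𝔉_m` from left to right: `(f_{t-1}, f_t) ⪯ (f_{t'-1}, f_{t'})` iff `t ≤ t'`,
that is, iff `f_{t-1} ≤ f_{t'-1}`. -/
def FareyLE (m : ℕ) (F F' : Set ℝ) : Prop :=
  ∃ a b a' b' : ℚ, FareySucc m a b ∧ FareySucc m a' b' ∧
    F = Set.Ioo (a : ℝ) (b : ℝ) ∧ F' = Set.Ioo (a' : ℝ) (b' : ℝ) ∧ a ≤ a'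

/-! ### Levelled trees with left-to-right order of siblings -/

/-- The data of a levelled tree whose level-`m` nodes are elements of `α m`. -/
structure LevelTree (α : ℕ → Type) where
  /-- the nodes of level `m` -/
  node : ∀ m, Set (α m)
  /-- `edge m p x`: the node `x` of level `m + 1` is a child of the node `p` of level `m` -/
  edge : ∀ m, α m → α (m + 1) → Prop
  /-- `sib m x y`: `x` and `y` are siblings at level `m + 1`, and `x` is drawn to the left of `y` -/
  sib : ∀ m, α (m + 1) → α (m + 1) → Prop

namespace LevelTree

variable {α β : ℕ → Type}

/-- `T` is a rooted binary tree whose levels are `1, …, M`, the root being the only node of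
level `1`, in which the siblings are ordered from left to right. -/
structure IsBinaryTree (T : LevelTree α) (M : ℕ) : Prop where
  level : ∀ m x, x ∈ T.node m → 1 ≤ m ∧ m ≤ M
  root : ∃ r, T.node 1 = {r}
  edge_mem : ∀ m p x, T.edge m p x → p ∈ T.node m ∧ x ∈ T.node (m + 1)
  parent : ∀ m, 1 ≤ m → ∀ x ∈ T.node (m + 1), ∃! p, T.edge m p x
  children : ∀ m p, {x | T.edge m p x}.encard ≤ 2
  sib_edge : ∀ m x y, T.sib m x y → x ≠ y ∧ ∃ p, T.edge m p x ∧ T.edge m p y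
  sib_total : ∀ m p x y, T.edge m p x → T.edge m p y → x ≠ y → Xor (T.sib m x y) (T.sib m y x)

/-- The strict horizontal (left-to-right) order of the nodes of one level: `x` is to the left of
`y` iff they are siblings in this order or the parent of `x` is to the left of the parent
of `y`. -/
def Left (T : LevelTree α) : ∀ m, α m → α m → Prop
  | 0, _, _ => False
  | m + 1, x, y =>
      T.sib m x y ∨ ∃ p q, T.edge m p x ∧ T.edge m q y ∧ T.Left m p q

/-- The tree obtained from `T` by replacing each node `x` of level `m` with `φ m x`. -/
def map (φ : ∀ m, α m → β m) (T : LevelTree α) : LevelTree β where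
  node m := φ m '' T.node m
  edge m p x := ∃ p' x', T.edge m p' x' ∧ φ m p' = p ∧ φ (m + 1) x' = x
  sib m x y := ∃ x' y', T.sib m x' y' ∧ φ (m + 1) x' = x ∧ φ (m + 1) y' = y

/-- The maps `e m` form an isomorphism of `T` onto `T'`: bijective on the nodes of each level,
preserving and reflecting edges and the left-to-right order of siblings. -/
structure IsIso (T : LevelTree α) (T' : LevelTree β) (e : ∀ m, α m → β m) : Prop where
  bij : ∀ m, Set.BijOn (e m) (T.node m) (T'.node m)
  edge_iff : ∀ m, ∀ p ∈ T.node m, ∀ x ∈ T.node (m + 1),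
    (T.edge m p x ↔ T'.edge m (e m p) (e (m + 1) x))
  sib_iff : ∀ m, ∀ x ∈ T.node (m + 1), ∀ y ∈ T.node (m + 1),
    (T.sib m x y ↔ T'.sib m (e (m + 1) x) (e (m + 1) y))

end LevelTree

/-! ### The three trees -/

/-- The generation tree `T_M`: the nodes of level `m ∈ [M]` are the elements of `𝒱_m`; the
children of `π ∈ 𝒱_m` are the `θ ∈ 𝒱_{m+1}` with `Ψ(Γ(θ)) = π`; of two siblings
`θ_{a,0}`, `θ_{a,1}`, the first is on the left. -/
def genTree (M : ℕ) : LevelTree fun m => Equiv.Perm (Fin m) where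
  node m := {θ | 1 ≤ m ∧ m ≤ M ∧ θ ∈ V m}
  edge m π θ := (1 ≤ m ∧ m + 1 ≤ M) ∧ π ∈ V m ∧ θ ∈ V (m + 1) ∧ Psi (Gam θ) = π
  sib m θ θ' := (1 ≤ m ∧ m + 1 ≤ M) ∧ θ ∈ V (m + 1) ∧ θ' ∈ V (m + 1) ∧
    Psi (Gam θ) ∈ V m ∧ Psi (Gam θ) = Psi (Gam θ') ∧
    ∃ a : ℕ, a ∈ Finset.Icc 1 (m + 1) ∧ Nat.gcd a (m + 1) = 1 ∧ IsTheta a 0 θ ∧ IsTheta a 1 θ'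

/-- The Farey interval tree `T_{F,M}`: the nodes of level `m ∈ [M]` are the elements of `𝔉_m`; the
children of `F ∈ 𝔉_m` are the `F' ∈ 𝔉_{m+1}` contained in `F`; siblings are arranged in the
order of `𝔉_{m+1}`. -/
def fareyTree (M : ℕ) : LevelTree fun _ => Set ℝ where
  node m := {F | 1 ≤ m ∧ m ≤ M ∧ F ∈ fareyIntervals m}
  edge m F F' := (1 ≤ m ∧ m + 1 ≤ M) ∧
    F ∈ fareyIntervals m ∧ F' ∈ fareyIntervals (m + 1) ∧ F' ⊆ F
  sib m F' F'' := (1 ≤ m ∧ m + 1 ≤ M) ∧ F' ≠ F'' ∧ FareyLE (m + 1) F' F'' ∧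
    ∃ F ∈ fareyIntervals m, F' ⊆ F ∧ F'' ⊆ F

/-- The inverse `𝖥_m⁻¹[F]` of the bijection `𝖥_m : 𝒱_m → 𝔉_m`. -/
noncomputable def permOf (m : ℕ) (F : Set ℝ) : Equiv.Perm (Fin m) :=
  Function.invFunOn (fareyOf m) (V m) F

/-- `T_{S,M}`: the Farey interval tree with each node `F ∈ 𝔉_m` replaced with `𝖥_m⁻¹[F]`. -/
noncomputable def suranyiTree (M : ℕ) : LevelTree fun m => Equiv.Perm (Fin m) :=
  (fareyTree M).map permOf

end SosTree

namespace SosTree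

/-! ### One-based terms of a permutation -/

/-! If `IsTau α θ`, then θ(i) is the rank of {iα} among {α}, …, {mα}. Rotation by α preserves the
cyclic order of the circle, so counting ranks before and after a rotation gives two facts: θ
satisfies the recursion of 𝒱_m (`IsTau.mem_V`), and Ψ∘Γ takes the permutation of α in degree m+1 to
that of the same α in degree m (`IsTau.Psi_Gam`). Hence being a child means inclusion of the
parameter sets.

These sets are Farey intervals, because θ and the integer parts ⌊iα⌋, i ≤ m, determine each other
(`IsTau.floor_eq`, `IsTau.of_floor_eq`), and these parts jump only at fractions of denominator at
most m.

That every θ ∈ 𝒱_m has a parameter is an induction on m (`fareyOf_nonempty`). The possible first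
terms of a child of π are π(1) and π(1)+1, and both occur only if π(1)+π(m) = m+1. In that case
π(1)/(m+1) splits the interval of π, and irrational parameters on its two sides realise both
children.

Siblings θ_{a,0} and θ_{a,1} end in m+1 and in 1. So ⌊(m+1)α⌋ is larger for the second, whose
interval therefore lies on the right (`lt_of_isTheta`). Induction on the level extends this to all
nodes. -/

theorem term_of_mem {m : ℕ} (θ : Equiv.Perm (Fin m)) {i : ℕ} (h1 : 1 ≤ i) (h2 : i ≤ m) :
    term θ i = ((θ ⟨i - 1, by omega⟩ : ℕ) : ℤ) + 1 := by
  simp [term, h1, h2]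

theorem term_fin_succ {m : ℕ} (θ : Equiv.Perm (Fin m)) (k : Fin m) :
    term θ (k + 1) = ((θ k : ℕ) : ℤ) + 1 := by
  rw [term_of_mem θ (by omega) (by omega)]
  simp

theorem one_le_term {m : ℕ} (θ : Equiv.Perm (Fin m)) {i : ℕ} (h1 : 1 ≤ i) (h2 : i ≤ m) :
    1 ≤ term θ i := by
  rw [term_of_mem θ h1 h2]; omega

theorem term_le {m : ℕ} (θ : Equiv.Perm (Fin m)) {i : ℕ} (h1 : 1 ≤ i) (h2 : i ≤ m) :
    term θ i ≤ m := by
  rw [term_of_mem θ h1 h2]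
  have := (θ ⟨i - 1, by omega⟩).isLt
  omega

theorem term_inj {m : ℕ} (θ : Equiv.Perm (Fin m)) {i j : ℕ} (hi : 1 ≤ i) (hi' : i ≤ m)
    (hj : 1 ≤ j) (hj' : j ≤ m) (h : term θ i = term θ j) : i = j := by
  rw [term_of_mem θ hi hi', term_of_mem θ hj hj'] at h
  have h' : θ ⟨i - 1, by omega⟩ = θ ⟨j - 1, by omega⟩ := Fin.ext (by omega)
  have := congrArg Fin.val (θ.injective h')
  simp only at this
  omega

theorem term_ext {m : ℕ} {θ θ' : Equiv.Perm (Fin m)}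
    (h : ∀ i, 1 ≤ i → i ≤ m → term θ i = term θ' i) : θ = θ' := by
  ext k
  have := h (k + 1) (by omega) (by omega)
  rw [term_fin_succ, term_fin_succ] at this
  omega

theorem exists_term_eq {m : ℕ} (θ : Equiv.Perm (Fin m)) {v : ℤ} (h1 : 1 ≤ v) (h2 : v ≤ m) :
    ∃ i, 1 ≤ i ∧ i ≤ m ∧ term θ i = v := by
  obtain ⟨k, hk⟩ := θ.surjective ⟨(v - 1).toNat, by omega⟩
  refine ⟨k + 1, by omega, by omega, ?_⟩
  rw [term_fin_succ, hk]
  simp only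
  omega

theorem smod_eq_of_modEq {n : ℕ} {x y : ℤ} (h : x ≡ y [ZMOD n]) (h1 : 1 ≤ x) (h2 : x ≤ n) :
    x = smod n y := by
  have h' : x - 1 ≡ y - 1 [ZMOD n] := h.sub_right 1
  rw [smod, ← h'.eq, Int.emod_eq_of_lt (by omega) (by omega)]
  ring

/-! ### The recursion that defines `𝒱_m` -/

/-- All terms lie in [1, m], so the congruence leaves only two integer values, and the comparison
with θ(m) is strict by injectivity. In this linear form the recursion can be handled by `omega`. -/
theorem V_step {m : ℕ} {θ : Equiv.Perm (Fin m)} (hθ : θ ∈ V m) {i : ℕ} (h1 : 1 ≤ i)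
    (h2 : i < m) :
    (term θ i < term θ m ∧
      (term θ (i + 1) = term θ i + term θ 1 ∨ term θ (i + 1) = term θ i + term θ 1 - m)) ∨
    (term θ m < term θ i ∧
      (term θ (i + 1) = term θ i + term θ 1 - 1 ∨
        term θ (i + 1) = term θ i + term θ 1 - 1 - m)) := by
  have h := hθ i (Finset.mem_Icc.2 ⟨h1, by omega⟩)
  have a1 := one_le_term θ h1 h2.le
  have a2 := term_le θ h1 h2.le
  have b1 := one_le_term θ (i := i + 1) (by omega) h2
  have b2 := term_le θ (i := i + 1) (by omega) h2
  have c1 := one_le_term θ (i := 1) le_rfl (by omega)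
  have c2 := term_le θ (i := 1) le_rfl (by omega)
  have hne : term θ i ≠ term θ m := fun h => by
    have := term_inj θ h1 h2.le (by omega) le_rfl h
    omega
  have key : ∀ s : ℤ, 1 ≤ s → s ≤ 2 * m → term θ (i + 1) ≡ s [ZMOD m] →
      term θ (i + 1) = s ∨ term θ (i + 1) = s - m := by
    intro s hs1 hs2 hs
    rcases le_or_gt s m with hsm | hsm
    · left
      rw [smod_eq_of_modEq hs b1 b2]
      exact (smod_eq_of_modEq rfl hs1 hsm).symm
    · right
      have h3 : s - m ≡ s [ZMOD m] := Int.modEq_iff_dvd.2 ⟨1, by ring⟩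
      rw [smod_eq_of_modEq (hs.trans h3.symm) b1 b2]
      exact (smod_eq_of_modEq rfl (by omega) (by omega)).symm
  rcases lt_or_gt_of_ne hne with hlt | hgt
  · left
    refine ⟨hlt, key _ (by omega) (by omega) ?_⟩
    rw [if_neg (by omega), sub_zero] at h
    simpa [add_comm] using h.add_right (term θ i)
  · right
    refine ⟨hgt, key _ (by omega) (by omega) ?_⟩
    rw [if_pos hgt.le] at h
    have := h.add_right (term θ i)
    ring_nf at this ⊢
    exact this

theorem mem_V_of_step {m : ℕ} {θ : Equiv.Perm (Fin m)}
    (h : ∀ i, 1 ≤ i → i < m →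
      (term θ i < term θ m ∧
        (term θ (i + 1) = term θ i + term θ 1 ∨ term θ (i + 1) = term θ i + term θ 1 - m)) ∨
      (term θ m < term θ i ∧
        (term θ (i + 1) = term θ i + term θ 1 - 1 ∨
          term θ (i + 1) = term θ i + term θ 1 - 1 - m))) : θ ∈ V m := by
  intro i hi
  obtain ⟨h1, h2⟩ := Finset.mem_Icc.1 hi
  rw [Int.modEq_comm, Int.modEq_iff_dvd]
  rcases h i h1 (by omega) with ⟨h3, h4 | h4⟩ | ⟨h3, h4 | h4⟩
  · rw [if_neg (by omega)]; exact ⟨0, by rw [h4]; ring⟩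
  · rw [if_neg (by omega)]; exact ⟨-1, by rw [h4]; ring⟩
  · rw [if_pos h3.le]; exact ⟨0, by rw [h4]; ring⟩
  · rw [if_pos h3.le]; exact ⟨-1, by rw [h4]; ring⟩

/-! ### The parent of a permutation -/

theorem term_Psi_Gam {m : ℕ} (θ : Equiv.Perm (Fin (m + 1))) {i : ℕ} (h1 : 1 ≤ i) (h2 : i ≤ m) :
    (term θ 1 < term θ (i + 1) ∧ term (Psi (Gam θ)) i = term θ (i + 1) - term θ 1) ∨
    (term θ (i + 1) < term θ 1 ∧
      term (Psi (Gam θ)) i = term θ (i + 1) - term θ 1 + (m + 1)) := by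
  have e : term (Psi (Gam θ)) i = (term θ (i + 1) - term θ 1) % ((m + 1 : ℕ) : ℤ) := by
    rw [term_Psi _ i (Finset.mem_Icc.2 ⟨h1, h2⟩),
      term_Gam _ _ (Finset.mem_Icc.2 ⟨by omega, by omega⟩), smod]
    ring_nf
  have b1 := one_le_term θ (i := i + 1) (by omega) (by omega)
  have b2 := term_le θ (i := i + 1) (by omega) (by omega)
  have c1 := one_le_term θ (i := 1) le_rfl (by omega)
  have c2 := term_le θ (i := 1) le_rfl (by omega)
  have hne : term θ 1 ≠ term θ (i + 1) := fun h => by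
    have := term_inj θ le_rfl (by omega) (by omega) (by omega) h
    omega
  rcases lt_or_gt_of_ne hne with hlt | hgt
  · left
    refine ⟨hlt, ?_⟩
    rw [e, Int.emod_eq_of_lt (by omega) (by omega)]
  · right
    refine ⟨hgt, ?_⟩
    rw [e, ← Int.add_emod_right, Int.emod_eq_of_lt (by omega) (by omega)]
    push_cast
    ring

/-- The first term of a member of `𝒱_{m+1}` in terms of its parent `π`: it is `π(1)` or
`π(1) + 1`, according to the position of the last term. -/
theorem term_one_of_mem_V {m : ℕ} (hm : 1 ≤ m) {θ : Equiv.Perm (Fin (m + 1))}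
    (hθ : θ ∈ V (m + 1)) :
    (term θ 1 = term (Psi (Gam θ)) 1 ∧
      term (Psi (Gam θ)) 1 + term (Psi (Gam θ)) m ≤ m + 1) ∨
    (term θ 1 = term (Psi (Gam θ)) 1 + 1 ∧
      m + 1 ≤ term (Psi (Gam θ)) 1 + term (Psi (Gam θ)) m) := by
  have h1 := V_step hθ (i := 1) le_rfl (by omega)
  have h2 := term_Psi_Gam θ (i := 1) le_rfl hm
  have h3 := term_Psi_Gam θ (i := m) hm le_rfl
  have b1 := one_le_term θ (i := m + 1) (by omega) (by omega)
  have b2 := term_le θ (i := m + 1) (by omega) (by omega)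
  have c1 := one_le_term θ (i := 1) le_rfl (by omega)
  have c2 := term_le θ (i := 1) le_rfl (by omega)
  have d1 := one_le_term θ (i := 1 + 1) (by omega) (by omega)
  have d2 := term_le θ (i := 1 + 1) (by omega) (by omega)
  -- Let π be the parent. If θ(1) < θ(m+1), then π(1) = θ(1) and π(1)+π(m) = θ(m+1) ≤ m+1. Otherwise
  -- π(1) = θ(1)-1 and π(1)+π(m) = θ(m+1)+m ≥ m+1.
  push_cast at *
  omega

/-- A wrap modulo m+1 subtracts one unit more than a wrap modulo m. The indicators of the two
recursions and the relation π(1) = θ(1) or θ(1)-1 absorb exactly this unit, in each cyclic position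
of θ(i+1) relative to θ(1) and θ(m+1). -/
theorem Psi_Gam_mem_V {m : ℕ} (hm : 1 ≤ m) {θ : Equiv.Perm (Fin (m + 1))}
    (hθ : θ ∈ V (m + 1)) : Psi (Gam θ) ∈ V m := by
  refine mem_V_of_step fun i hi him => ?_
  have h0 := term_one_of_mem_V hm hθ
  have h1 := V_step hθ (i := i + 1) (by omega) (by omega)
  have h2 := term_Psi_Gam θ (i := i) hi him.le
  have h2' := term_Psi_Gam θ (i := i + 1) (by omega) him
  have h3 := term_Psi_Gam θ (i := m) hm le_rfl
  have b1 := one_le_term θ (i := m + 1) (by omega) (by omega)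
  have b2 := term_le θ (i := m + 1) (by omega) (by omega)
  have c1 := one_le_term θ (i := 1) le_rfl (by omega)
  have c2 := term_le θ (i := 1) le_rfl (by omega)
  have d1 := one_le_term θ (i := i + 1) (by omega) (by omega)
  have d2 := term_le θ (i := i + 1) (by omega) (by omega)
  have e1 := one_le_term θ (i := i + 1 + 1) (by omega) (by omega)
  have e2 := term_le θ (i := i + 1 + 1) (by omega) (by omega)
  push_cast at *
  omega

/-- A permutation is determined by its parent and its first term. -/
theorem eq_of_Psi_Gam_eq {m : ℕ} {θ θ' : Equiv.Perm (Fin (m + 1))}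
    (h : Psi (Gam θ) = Psi (Gam θ')) (h1 : term θ 1 = term θ' 1) : θ = θ' := by
  refine term_ext fun i hi hi' => ?_
  obtain ⟨k, rfl⟩ := Nat.exists_eq_add_of_le' hi
  rcases Nat.eq_zero_or_pos k with rfl | hk
  · exact h1
  have a := term_Psi_Gam θ (i := k) hk (by omega)
  have b := term_Psi_Gam θ' (i := k) hk (by omega)
  rw [← h, ← h1] at b
  have d1 := one_le_term θ (i := k + 1) (by omega) (by omega)
  have d2 := term_le θ (i := k + 1) (by omega) (by omega)
  have e1 := one_le_term θ' (i := k + 1) (by omega) (by omega)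
  have e2 := term_le θ' (i := k + 1) (by omega) (by omega)
  push_cast at *
  omega

/-- Two different siblings: the one with the smaller first term has first term `π(1)`, the other
one `π(1) + 1`, and `π(1) + π(m) = m + 1`. -/
theorem siblings_term_one {m : ℕ} (hm : 1 ≤ m) {θ θ' : Equiv.Perm (Fin (m + 1))}
    (hθ : θ ∈ V (m + 1)) (hθ' : θ' ∈ V (m + 1)) (h : Psi (Gam θ) = Psi (Gam θ')) (hne : θ ≠ θ') :
    term (Psi (Gam θ)) 1 + term (Psi (Gam θ)) m = m + 1 ∧
    ((term θ 1 = term (Psi (Gam θ)) 1 ∧ term θ' 1 = term (Psi (Gam θ)) 1 + 1) ∨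
      (term θ' 1 = term (Psi (Gam θ)) 1 ∧ term θ 1 = term (Psi (Gam θ)) 1 + 1)) := by
  have a := term_one_of_mem_V hm hθ
  have b := term_one_of_mem_V hm hθ'
  have c : term θ 1 ≠ term θ' 1 := fun h1 => hne (eq_of_Psi_Gam_eq h h1)
  rw [← h] at b
  omega

theorem two_children {m : ℕ} (hm : 1 ≤ m) {θ₁ θ₂ θ : Equiv.Perm (Fin (m + 1))}
    (h₁ : θ₁ ∈ V (m + 1)) (h₂ : θ₂ ∈ V (m + 1)) (hθ : θ ∈ V (m + 1))
    (e₁ : Psi (Gam θ₁) = Psi (Gam θ)) (e₂ : Psi (Gam θ₂) = Psi (Gam θ)) (hne : θ₁ ≠ θ₂) :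
    θ = θ₁ ∨ θ = θ₂ := by
  have a := siblings_term_one hm h₁ h₂ (e₁.trans e₂.symm) hne
  have b := term_one_of_mem_V hm hθ
  rw [e₁] at a
  have : term θ 1 = term θ₁ 1 ∨ term θ 1 = term θ₂ 1 := by omega
  exact this.imp (eq_of_Psi_Gam_eq e₁.symm) (eq_of_Psi_Gam_eq e₂.symm)

/-- If `π(1) + π(m) = m + 1`, then `π(i)` is the residue of `i π(1)` modulo `m + 1`. -/
theorem term_modEq_of_add_eq {m : ℕ} {π : Equiv.Perm (Fin m)} (hπ : π ∈ V m)
    (h : term π 1 + term π m = m + 1) {i : ℕ} (h1 : 1 ≤ i) (h2 : i ≤ m) :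
    term π i ≡ i * term π 1 [ZMOD (m + 1 : ℕ)] := by
  induction i, h1 using Nat.le_induction with
  | base => simp
  | succ i hi ih =>
    have ih' := (ih (by omega)).add_right (term π 1)
    have a := V_step hπ hi (by omega)
    have d1 := one_le_term π (i := i + 1) (by omega) (by omega)
    have d2 := term_le π (i := i + 1) (by omega) (by omega)
    -- If π(i) < π(m), then π(i)+π(1) < m+1 and nothing wraps. If π(i) > π(m), then π(i)+π(1)-1 > m
    -- must wrap, and the indicator together with the wrap by m makes m+1.
    have h3 : term π (i + 1) = term π i + term π 1 ∨
        term π (i + 1) = term π i + term π 1 - (m + 1) := by omega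
    have h4 : term π (i + 1) ≡ term π i + term π 1 [ZMOD (m + 1 : ℕ)] := by
      rw [Int.modEq_iff_dvd]
      rcases h3 with h3 | h3
      · exact ⟨0, by rw [h3]; ring⟩
      · exact ⟨1, by rw [h3]; push_cast; ring⟩
    refine h4.trans ?_
    push_cast at ih' ⊢
    rw [add_mul, one_mul]
    exact ih'

theorem isTheta_of_Psi_Gam {m : ℕ} {θ : Equiv.Perm (Fin (m + 1))}
    (hπ : Psi (Gam θ) ∈ V m)
    (h : term (Psi (Gam θ)) 1 + term (Psi (Gam θ)) m = m + 1) :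
    IsTheta (term (Psi (Gam θ)) 1) (term θ 1 - term (Psi (Gam θ)) 1) θ := by
  intro i hi
  obtain ⟨hi, hi'⟩ := Finset.mem_Icc.1 hi
  refine smod_eq_of_modEq ?_ (one_le_term θ hi hi') (term_le θ hi hi')
  obtain ⟨k, rfl⟩ := Nat.exists_eq_add_of_le' hi
  rcases Nat.eq_zero_or_pos k with rfl | hk
  · simp
  have a := (term_modEq_of_add_eq hπ h hk (by omega)).add_right (term θ 1)
  have b : term θ (k + 1) ≡ term (Psi (Gam θ)) k + term θ 1 [ZMOD (m + 1 : ℕ)] := by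
    rw [Int.modEq_iff_dvd]
    rcases term_Psi_Gam θ (i := k) hk (by omega) with ⟨-, e⟩ | ⟨-, e⟩
    · exact ⟨0, by rw [e]; ring⟩
    · exact ⟨1, by rw [e]; push_cast; ring⟩
  have e : (k : ℤ) * term (Psi (Gam θ)) 1 + term θ 1 =
      term (Psi (Gam θ)) 1 * ((k + 1 : ℕ) : ℤ) + (term θ 1 - term (Psi (Gam θ)) 1) := by
    push_cast
    ring
  exact e ▸ b.trans a

/-- The value 1 is taken at some i, and then i is an inverse of π(1) modulo m+1. -/
theorem gcd_term_one_of_add_eq {m : ℕ} (hm : 1 ≤ m) {π : Equiv.Perm (Fin m)} (hπ : π ∈ V m)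
    (h : term π 1 + term π m = m + 1) : Nat.gcd (term π 1).toNat (m + 1) = 1 := by
  obtain ⟨i, h1, h2, h3⟩ := exists_term_eq π (v := 1) le_rfl (by omega)
  have a := term_modEq_of_add_eq hπ h h1 h2
  rw [h3] at a
  have b := one_le_term π (i := 1) le_rfl hm
  have c : IsCoprime (term π 1) ((m + 1 : ℕ) : ℤ) := by
    obtain ⟨c, hc⟩ := Int.modEq_iff_dvd.1 a
    exact ⟨i, -c, by linarith⟩
  rw [← Nat.coprime_iff_gcd_eq_one, ← Nat.isCoprime_iff_coprime, Int.toNat_of_nonneg (by omega)]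
  exact c

/-- At i = n the multiple of a vanishes modulo n, so the last term alone distinguishes the left
sibling from the right one. -/
theorem IsTheta.term_last {n : ℕ} (hn : 1 ≤ n) {a b : ℤ} {θ : Equiv.Perm (Fin n)}
    (h : IsTheta a b θ) : term θ n = smod n b := by
  rw [h n (Finset.mem_Icc.2 ⟨hn, le_rfl⟩), smod, smod,
    show a * (n : ℤ) + b - 1 = b - 1 + n * a by ring, Int.add_mul_emod_self_left]

theorem IsTheta.term_last_zero {n : ℕ} (hn : 1 ≤ n) {a : ℤ} {θ : Equiv.Perm (Fin n)}
    (h : IsTheta a 0 θ) : term θ n = n := by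
  rw [h.term_last hn]
  refine (smod_eq_of_modEq ?_ (by omega) le_rfl).symm
  exact Int.modEq_iff_dvd.2 ⟨-1, by ring⟩

theorem IsTheta.term_last_one {n : ℕ} (hn : 1 ≤ n) {a : ℤ} {θ : Equiv.Perm (Fin n)}
    (h : IsTheta a 1 θ) : term θ n = 1 := by
  rw [h.term_last hn]
  exact (smod_eq_of_modEq rfl le_rfl (by omega)).symm

/-! ### The generation tree is binary -/

theorem V_one (θ : Equiv.Perm (Fin 1)) : θ ∈ V 1 := by
  intro i hi
  simp at hi

theorem isBinaryTree_genTree {M : ℕ} (hM : 1 ≤ M) : (genTree M).IsBinaryTree M where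
  level _ _ h := ⟨h.1, h.2.1⟩
  root := ⟨1, Set.eq_singleton_iff_unique_mem.2
    ⟨⟨le_rfl, hM, V_one 1⟩, fun _ _ => Subsingleton.elim _ _⟩⟩
  edge_mem m p x h := ⟨⟨h.1.1, (Nat.le_succ m).trans h.1.2, h.2.1⟩,
    ⟨Nat.le_add_left 1 m, h.1.2, h.2.2.1⟩⟩
  parent m hm x hx :=
    ⟨Psi (Gam x), ⟨⟨hm, hx.2.1⟩, Psi_Gam_mem_V hm hx.2.2, hx.2.2, rfl⟩, fun _ h => h.2.2.2.symm⟩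
  children m p := by
    by_cases h : ∃ x y, (genTree M).edge m p x ∧ (genTree M).edge m p y ∧ x ≠ y
    · obtain ⟨x, y, hx, hy, hne⟩ := h
      refine (Set.encard_le_encard (t := {x, y}) fun z hz => ?_).trans (Set.encard_pair hne).le
      exact two_children hx.1.1 hx.2.2.1 hy.2.2.1 hz.2.2.1 (hx.2.2.2.trans hz.2.2.2.symm)
        (hy.2.2.2.trans hz.2.2.2.symm) hne
    · push Not at h
      exact (Set.encard_le_one_iff.2 fun x y hx hy => h x y hx hy).trans (by norm_num)
  sib_edge m x y h := by
    obtain ⟨hm, hx, hy, hp, he, a, -, -, h0, h1⟩ := h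
    refine ⟨?_, _, ⟨hm, hp, hx, rfl⟩, ⟨hm, hp, hy, he.symm⟩⟩
    rintro rfl
    have := h0.term_last_zero (by omega)
    have := h1.term_last_one (by omega)
    omega
  sib_total m p x y hx hy hne := by
    obtain ⟨hm, hp, hx, rfl⟩ := hx
    obtain ⟨-, -, hy, he⟩ := hy
    -- The multiplier is a = π(1) for the common parent π, and the offset b is the excess of the
    -- first term over π(1).
    have hs : ∀ x y : Equiv.Perm (Fin (m + 1)), x ∈ V (m + 1) → y ∈ V (m + 1) →
        Psi (Gam x) ∈ V m → Psi (Gam x) = Psi (Gam y) →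
        term (Psi (Gam x)) 1 + term (Psi (Gam x)) m = m + 1 →
        term x 1 = term (Psi (Gam x)) 1 → term y 1 = term (Psi (Gam x)) 1 + 1 →
        (genTree M).sib m x y := by
      intro x y hx hy hp he hs h0 h1
      have b := one_le_term (Psi (Gam x)) (i := 1) le_rfl hm.1
      have b' := term_le (Psi (Gam x)) (i := 1) le_rfl hm.1
      refine ⟨hm, hx, hy, hp, he, (term (Psi (Gam x)) 1).toNat,
        Finset.mem_Icc.2 ⟨by omega, by omega⟩, gcd_term_one_of_add_eq hm.1 hp hs, ?_, ?_⟩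
      · have := isTheta_of_Psi_Gam hp hs
        rwa [h0, sub_self, ← Int.toNat_of_nonneg (by omega : 0 ≤ term (Psi (Gam x)) 1)] at this
      · have := isTheta_of_Psi_Gam (θ := y) (he ▸ hp) (he ▸ hs)
        rwa [← he, h1, add_sub_cancel_left,
          ← Int.toNat_of_nonneg (by omega : 0 ≤ term (Psi (Gam x)) 1)] at this
    have hex : ∀ x y : Equiv.Perm (Fin (m + 1)), (genTree M).sib m x y →
        ¬ (genTree M).sib m y x := by
      rintro x y ⟨_, _, _, _, _, a, _, _, h0, _⟩ ⟨_, _, _, _, _, b, _, _, _, h1⟩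
      have := h0.term_last_zero (by omega)
      have := h1.term_last_one (by omega)
      omega
    obtain ⟨hsum, ⟨h0, h1⟩ | ⟨h0, h1⟩⟩ := siblings_term_one hm.1 hx hy he.symm hne
    · have := hs x y hx hy hp he.symm hsum h0 h1
      exact Or.inl ⟨this, hex _ _ this⟩
    · have := hs y x hy hx (he ▸ hp) he (he ▸ hsum) (he ▸ h0) (he ▸ h1)
      exact Or.inr ⟨this, hex _ _ this⟩

/-! ### Ordering of the fractional parts -/

/-- `α ∈ (0, 1)` and none of `α, 2α, …, mα` is an integer. -/
def Generic (m : ℕ) (α : ℝ) : Prop :=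
  0 < α ∧ α < 1 ∧ ∀ i : ℕ, 1 ≤ i → i ≤ m → Int.fract (i * α) ≠ 0

theorem Generic.mono {m n : ℕ} {α : ℝ} (h : Generic n α) (hmn : m ≤ n) : Generic m α :=
  ⟨h.1, h.2.1, fun i hi hi' => h.2.2 i hi (hi'.trans hmn)⟩

theorem Generic.of_irrational {m : ℕ} {α : ℝ} (h0 : 0 < α) (h1 : α < 1) (h : Irrational α) :
    Generic m α := by
  refine ⟨h0, h1, fun i hi _ hf => ?_⟩
  have h2 := (irrational_natCast_mul_iff (n := i) (x := α)).2 ⟨by omega, h⟩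
  obtain ⟨z, hz⟩ := Int.fract_eq_zero_iff.1 hf
  exact h2.ne_int z hz.symm

/-- Passes from σ = θ⁻¹ to θ itself, whose terms are ordered like the fractional parts {iα}. -/
theorem isTau_iff {m : ℕ} {α : ℝ} {θ : Equiv.Perm (Fin m)} :
    IsTau α θ ↔ (∀ i : ℕ, 1 ≤ i → i ≤ m → 0 < Int.fract (i * α)) ∧
      ∀ i j : ℕ, 1 ≤ i → i ≤ m → 1 ≤ j → j ≤ m →
        (Int.fract (i * α) < Int.fract (j * α) ↔ term θ i < term θ j) := by
  constructor
  · rintro ⟨h0, h1⟩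
    have key : ∀ i (hi : 1 ≤ i) (hi' : i ≤ m),
        ((((θ⁻¹ (θ ⟨i - 1, by omega⟩) : Fin m) : ℕ) : ℝ) + 1) * α = i * α := by
      intro i hi hi'
      rw [show θ⁻¹ (θ ⟨i - 1, by omega⟩) = ⟨i - 1, by omega⟩ from θ.symm_apply_apply _]
      push_cast [hi]
      ring
    refine ⟨fun i hi hi' => ?_, fun i j hi hi' hj hj' => ?_⟩
    · have := h0 (θ ⟨i - 1, by omega⟩)
      rwa [key i hi hi'] at this
    · have := h1.lt_iff_lt (a := θ ⟨i - 1, by omega⟩) (b := θ ⟨j - 1, by omega⟩)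
      simp only [key i hi hi', key j hj hj'] at this
      rw [this, term_of_mem θ hi hi', term_of_mem θ hj hj', Fin.lt_def]
      omega
  · rintro ⟨h0, h1⟩
    refine ⟨fun i => ?_, fun i j hij => ?_⟩
    · have := h0 ((θ⁻¹ i : Fin m) + 1) (by omega) (by omega)
      push_cast at this
      exact this
    · have := (h1 ((θ⁻¹ i : Fin m) + 1) ((θ⁻¹ j : Fin m) + 1) (by omega) (by omega) (by omega)
        (by omega)).2 (by
          rw [term_fin_succ, term_fin_succ, show θ (θ⁻¹ i) = i from θ.apply_symm_apply i,
            show θ (θ⁻¹ j) = j from θ.apply_symm_apply j]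
          have := Fin.lt_def.1 hij
          omega)
      push_cast at this
      exact this

theorem IsTau.le_iff {m : ℕ} {α : ℝ} {θ : Equiv.Perm (Fin m)} (h : IsTau α θ) {i j : ℕ}
    (hi : 1 ≤ i) (hi' : i ≤ m) (hj : 1 ≤ j) (hj' : j ≤ m) :
    Int.fract (i * α) ≤ Int.fract (j * α) ↔ term θ i ≤ term θ j := by
  rw [← not_lt, ← not_lt, (isTau_iff.1 h).2 j i hj hj' hi hi']

theorem IsTau.generic {m : ℕ} {α : ℝ} {θ : Equiv.Perm (Fin m)} (h : IsTau α θ) (h0 : 0 < α)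
    (h1 : α < 1) : Generic m α :=
  ⟨h0, h1, fun i hi hi' => ((isTau_iff.1 h).1 i hi hi').ne'⟩

theorem term_eq_sum {m : ℕ} {α : ℝ} {θ : Equiv.Perm (Fin m)} (h : IsTau α θ) {i : ℕ}
    (hi : 1 ≤ i) (hi' : i ≤ m) :
    term θ i = ∑ j ∈ Finset.range m,
      if Int.fract (((j + 1 : ℕ) : ℝ) * α) ≤ Int.fract (i * α) then (1 : ℤ) else 0 := by
  rw [Finset.sum_range]
  have e : ∀ k : Fin m, (if Int.fract ((((k : ℕ) + 1 : ℕ) : ℝ) * α) ≤ Int.fract (i * α)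
      then (1 : ℤ) else 0) = if θ k ≤ θ ⟨i - 1, by omega⟩ then 1 else 0 := by
    intro k
    refine if_congr ?_ rfl rfl
    rw [h.le_iff (by omega) (by omega) hi hi', term_fin_succ, term_of_mem θ hi hi', Fin.le_def]
    omega
  rw [Finset.sum_congr rfl fun k _ => e k,
    Equiv.sum_comp θ (fun k => if k ≤ θ ⟨i - 1, by omega⟩ then (1 : ℤ) else 0),
    Finset.sum_boole, term_of_mem θ hi hi']
  have : (Finset.univ.filter fun k => k ≤ θ ⟨i - 1, by omega⟩) =
      Finset.Iic (θ ⟨i - 1, by omega⟩) := by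
    ext k; simp
  rw [this, Fin.card_Iic]
  push_cast
  ring

theorem isTau_unique {m : ℕ} {α : ℝ} {θ θ' : Equiv.Perm (Fin m)} (h : IsTau α θ)
    (h' : IsTau α θ') : θ = θ' :=
  term_ext fun _ hi hi' => (term_eq_sum h hi hi').trans (term_eq_sum h' hi hi').symm

/-- The strict inequality drops only the point {α} itself, which is the summand j = 0. -/
theorem term_one_sub_one_eq_sum {m : ℕ} (hm : 1 ≤ m) {α : ℝ} {θ : Equiv.Perm (Fin m)}
    (h : IsTau α θ) :
    term θ 1 - 1 = ∑ j ∈ Finset.range m,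
      if Int.fract (((j + 1 : ℕ) : ℝ) * α) < Int.fract α then (1 : ℤ) else 0 := by
  have e : ∀ j ∈ Finset.range m, (if Int.fract (((j + 1 : ℕ) : ℝ) * α) < Int.fract α
      then (1 : ℤ) else 0) = (if Int.fract (((j + 1 : ℕ) : ℝ) * α) ≤ Int.fract ((1 : ℕ) * α)
      then (1 : ℤ) else 0) - if j = 0 then 1 else 0 := by
    intro j hj
    have hj' := Finset.mem_range.1 hj
    have a := h.le_iff (i := j + 1) (j := 1) (by omega) (by omega) le_rfl hm
    have b := (isTau_iff.1 h).2 (j + 1) 1 (by omega) (by omega) le_rfl hm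
    have c : term θ (j + 1) = term θ 1 → j = 0 := fun h => by
      have := term_inj θ (by omega) (by omega) le_rfl hm h
      omega
    rw [if_congr a rfl rfl]
    rw [show Int.fract α = Int.fract ((1 : ℕ) * α) by simp, if_congr b rfl rfl]
    rcases Nat.eq_zero_or_pos j with rfl | hj0
    · simp
    · have : term θ (j + 1) ≠ term θ 1 := fun h => by have := c h; omega
      rw [if_neg (by omega : j ≠ 0), sub_zero]
      exact if_congr ⟨fun h => h.le, fun h => lt_of_le_of_ne h this⟩ rfl rfl
  rw [Finset.sum_congr rfl e, Finset.sum_sub_distrib, ← term_eq_sum h le_rfl hm,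
    Finset.sum_ite_eq' (Finset.range m) 0 (fun _ => (1 : ℤ)), if_pos (Finset.mem_range.2 hm)]

/-! ### Rotation by `α` -/

theorem fract_add_cases (x : ℝ) {α : ℝ} (h0 : 0 < α) (h1 : α < 1) :
    (Int.fract x + α < 1 ∧ ⌊x + α⌋ = ⌊x⌋ ∧ Int.fract (x + α) = Int.fract x + α) ∨
    (1 ≤ Int.fract x + α ∧ ⌊x + α⌋ = ⌊x⌋ + 1 ∧ Int.fract (x + α) = Int.fract x + α - 1) := by
  have hx := Int.floor_add_fract x
  have hf := Int.fract_nonneg x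
  have hf' := Int.fract_lt_one x
  rcases lt_or_ge (Int.fract x + α) 1 with h | h
  · have e : ⌊x + α⌋ = ⌊x⌋ := by
      rw [Int.floor_eq_iff]; constructor <;> linarith
    exact Or.inl ⟨h, e, by rw [← Int.self_sub_floor, e]; linarith⟩
  · have e : ⌊x + α⌋ = ⌊x⌋ + 1 := by
      rw [Int.floor_eq_iff]; push_cast; constructor <;> linarith
    exact Or.inr ⟨h, e, by rw [← Int.self_sub_floor, e]; push_cast; linarith⟩

/-- A rotation by α changes the linear order only through points carried past 0, and these are the
points that land in [0, α). -/
theorem rotation_indicator (x y : ℝ) {α : ℝ} (h0 : 0 < α) (h1 : α < 1) :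
    (if Int.fract y ≤ Int.fract x then (1 : ℤ) else 0) =
      (if Int.fract (y + α) ≤ Int.fract (x + α) then 1 else 0) -
      (if Int.fract (y + α) < Int.fract α then 1 else 0) +
      (if Int.fract (x + α) < Int.fract α then 1 else 0) := by
  have hα : Int.fract α = α := Int.fract_eq_self.2 ⟨h0.le, h1⟩
  have a := Int.fract_nonneg x
  have a' := Int.fract_lt_one x
  have b := Int.fract_nonneg y
  have b' := Int.fract_lt_one y
  rw [hα]
  rcases fract_add_cases x h0 h1 with ⟨hx, -, ex⟩ | ⟨hx, -, ex⟩ <;>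
  rcases fract_add_cases y h0 h1 with ⟨hy, -, ey⟩ | ⟨hy, -, ey⟩ <;>
  rw [ex, ey]
  · rw [if_neg (by linarith : ¬ Int.fract y + α < α), if_neg (by linarith : ¬ Int.fract x + α < α)]
    simp
  · rw [if_neg (by linarith : ¬ Int.fract y ≤ Int.fract x), if_pos (by linarith),
      if_pos (by linarith), if_neg (by linarith)]
    simp
  · rw [if_pos (by linarith : Int.fract y ≤ Int.fract x), if_neg (by linarith),
      if_neg (by linarith), if_pos (by linarith)]
    simp
  · rw [if_pos (by linarith : Int.fract y + α - 1 < α), if_pos (by linarith : _ - 1 < α)]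
    simp

theorem rotation_sum (n i : ℕ) {α : ℝ} (h0 : 0 < α) (h1 : α < 1) :
    (∑ j ∈ Finset.range n, if Int.fract ((j : ℝ) * α) ≤ Int.fract (i * α) then (1 : ℤ) else 0) =
      (∑ j ∈ Finset.range n, if Int.fract (((j + 1 : ℕ) : ℝ) * α) ≤
        Int.fract (((i + 1 : ℕ) : ℝ) * α) then (1 : ℤ) else 0) -
      (∑ j ∈ Finset.range n, if Int.fract (((j + 1 : ℕ) : ℝ) * α) < Int.fract α
        then (1 : ℤ) else 0) +
      n * (if Int.fract (((i + 1 : ℕ) : ℝ) * α) < Int.fract α then 1 else 0) := by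
  have e : ∀ k : ℕ, ((k + 1 : ℕ) : ℝ) * α = k * α + α := fun k => by push_cast; ring
  simp only [e]
  rw [Finset.sum_congr rfl fun (j : ℕ) _ => rotation_indicator (i * α) (j * α) h0 h1]
  simp only [Finset.sum_add_distrib, Finset.sum_sub_distrib, Finset.sum_const, Finset.card_range,
    nsmul_eq_mul]

theorem rank_from_zero (m i : ℕ) (α : ℝ) :
    (∑ j ∈ Finset.range (m + 1), if Int.fract ((j : ℝ) * α) ≤ Int.fract (i * α)
      then (1 : ℤ) else 0) = (∑ j ∈ Finset.range m, if Int.fract (((j + 1 : ℕ) : ℝ) * α) ≤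
        Int.fract (i * α) then (1 : ℤ) else 0) + 1 := by
  rw [Finset.sum_range_succ']
  simp

/-- The rank of {iα} among the points 0, {α}, …, {mα} is θ(i)+1. Splitting off {mα} gives the
indicator of the recursion, and rotating the remaining m points gives θ(i+1)-θ(1)+1 up to a multiple
of m. -/
theorem IsTau.mem_V {m : ℕ} {α : ℝ} (h0 : 0 < α) (h1 : α < 1) {θ : Equiv.Perm (Fin m)}
    (h : IsTau α θ) : θ ∈ V m := by
  intro i hi
  obtain ⟨hi, hi'⟩ := Finset.mem_Icc.1 hi
  have a := rank_from_zero m i α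
  rw [Finset.sum_range_succ, rotation_sum m i h0 h1, ← term_eq_sum h hi (by omega),
    ← term_one_sub_one_eq_sum (by omega) h, ← term_eq_sum h (by omega) (by omega),
    if_congr (h.le_iff (by omega) le_rfl hi (by omega)) rfl rfl] at a
  rw [Int.modEq_iff_dvd]
  refine ⟨if Int.fract (((i + 1 : ℕ) : ℝ) * α) < Int.fract α then 1 else 0, ?_⟩
  linarith

theorem exists_isTau {m : ℕ} {α : ℝ} (h : Generic m α) : ∃ θ : Equiv.Perm (Fin m), IsTau α θ := by
  let f : Fin m → ℝ := fun i => Int.fract (((i : ℕ) + 1) * α)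
  have hne : ∀ i j : Fin m, i < j → f i ≠ f j := by
    intro i j hij hf
    have hij' := Fin.lt_def.1 hij
    obtain ⟨z, hz⟩ := Int.fract_eq_fract.1 hf
    refine h.2.2 (j - i) (by omega) (by omega) (Int.fract_eq_zero_iff.2 ⟨-z, ?_⟩)
    push_cast [hij'.le]
    rw [← hz]
    ring
  have hinj : Function.Injective f := by
    intro i j hf
    rcases lt_trichotomy i j with hij | hij | hij
    · exact absurd hf (hne i j hij)
    · exact hij
    · exact absurd hf.symm (hne j i hij)
  refine ⟨(Tuple.sort f)⁻¹, fun i => ?_, ?_⟩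
  · rw [inv_inv]
    have := h.2.2 (Tuple.sort f i + 1) (by omega) (by omega)
    push_cast at this
    exact lt_of_le_of_ne (Int.fract_nonneg _) this.symm
  · rw [inv_inv]
    exact (Tuple.monotone_sort f).strictMono_of_injective
      (hinj.comp (Tuple.sort f).injective)

/-- The same count, now with all m+1 points 0, {α}, …, {mα} rotated onto {α}, …, {(m+1)α}: the rank
π(i)+1 becomes θ(i+1)-θ(1)+1, plus m+1 in case of a wrap. -/
theorem IsTau.Psi_Gam {m : ℕ} {α : ℝ} (h0 : 0 < α) (h1 : α < 1) {θ : Equiv.Perm (Fin (m + 1))}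
    (h : IsTau α θ) : IsTau α (Psi (Gam θ)) := by
  obtain ⟨π, hπ⟩ := exists_isTau ((h.generic h0 h1).mono (Nat.le_succ m))
  convert hπ
  refine term_ext fun i hi hi' => ?_
  have a := rank_from_zero m i α
  have e : Int.fract α = Int.fract ((1 : ℕ) * α) := by simp
  rw [rotation_sum (m + 1) i h0 h1, ← term_eq_sum hπ hi hi',
    ← term_one_sub_one_eq_sum (by omega) h, ← term_eq_sum h (by omega) (by omega), e,
    if_congr ((isTau_iff.1 h).2 _ _ (by omega) (by omega) le_rfl (by omega)) rfl rfl] at a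
  rcases term_Psi_Gam θ hi hi' with ⟨h2, h3⟩ | ⟨h2, h3⟩
  · rw [if_neg (by omega)] at a
    linarith
  · rw [if_pos h2] at a
    push_cast at a
    linarith

/-! ### Integer parts -/

theorem floor_succ_mul (i : ℕ) {α : ℝ} (h0 : 0 < α) (h1 : α < 1) :
    ⌊((i + 1 : ℕ) : ℝ) * α⌋ = ⌊(i : ℝ) * α⌋ +
      if Int.fract (((i + 1 : ℕ) : ℝ) * α) < Int.fract (i * α) then 1 else 0 := by
  rw [show ((i + 1 : ℕ) : ℝ) * α = i * α + α by push_cast; ring]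
  rcases fract_add_cases (i * α) h0 h1 with ⟨-, h2, h3⟩ | ⟨-, h2, h3⟩
  · rw [h2, h3, if_neg (by linarith), add_zero]
  · rw [h2, h3, if_pos (by linarith)]

theorem IsTau.floor_succ_mul {m : ℕ} {α : ℝ} (h0 : 0 < α) (h1 : α < 1) {θ : Equiv.Perm (Fin m)}
    (h : IsTau α θ) {i : ℕ} (hi : 1 ≤ i) (hi' : i < m) :
    ⌊((i + 1 : ℕ) : ℝ) * α⌋ = ⌊(i : ℝ) * α⌋ + if term θ (i + 1) < term θ i then 1 else 0 := by
  rw [SosTree.floor_succ_mul i h0 h1,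
    if_congr ((isTau_iff.1 h).2 _ _ (by omega) (by omega) hi hi'.le) rfl rfl]

/-- The integer part ⌊iα⌋ grows by one exactly at the descents of θ, so it depends on θ only. -/
theorem IsTau.floor_eq {m : ℕ} {α β : ℝ} {θ : Equiv.Perm (Fin m)} (h : IsTau α θ)
    (h0 : 0 < α) (h1 : α < 1) (h' : IsTau β θ) (h0' : 0 < β) (h1' : β < 1) {i : ℕ}
    (hi : 1 ≤ i) (hi' : i ≤ m) : ⌊(i : ℝ) * α⌋ = ⌊(i : ℝ) * β⌋ := by
  induction i, hi using Nat.le_induction with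
  | base =>
    rw [Nat.cast_one, one_mul, one_mul, Int.floor_eq_zero_iff.2 ⟨h0.le, h1⟩,
      Int.floor_eq_zero_iff.2 ⟨h0'.le, h1'⟩]
  | succ i hi ih =>
    rw [h.floor_succ_mul h0 h1 hi hi', h'.floor_succ_mul h0' h1' hi hi', ih (by omega)]

/-- {jα}-{iα} differs from (j-i)α by the integer ⌊jα⌋-⌊iα⌋, so its sign is read off from ⌊(j-i)α⌋.
Genericity excludes the value zero. -/
theorem Generic.fract_lt_iff {m : ℕ} {α : ℝ} (h : Generic m α) {i j : ℕ} (hij : i < j)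
    (hj : j ≤ m) : (Int.fract (i * α) < Int.fract (j * α) ↔
      ⌊(j : ℝ) * α⌋ - ⌊(i : ℝ) * α⌋ ≤ ⌊((j - i : ℕ) : ℝ) * α⌋) ∧
    (Int.fract (j * α) < Int.fract (i * α) ↔
      ¬ ⌊(j : ℝ) * α⌋ - ⌊(i : ℝ) * α⌋ ≤ ⌊((j - i : ℕ) : ℝ) * α⌋) := by
  have hne := h.2.2 (j - i) (by omega) (by omega)
  have e : ((j - i : ℕ) : ℝ) * α - ((⌊(j : ℝ) * α⌋ - ⌊(i : ℝ) * α⌋ : ℤ) : ℝ) =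
      Int.fract (j * α) - Int.fract (i * α) := by
    rw [← Int.self_sub_floor, ← Int.self_sub_floor]
    push_cast [hij.le]
    ring
  have hne' : Int.fract (j * α) - Int.fract (i * α) ≠ 0 := fun h0 => by
    rw [h0, sub_eq_zero] at e
    exact hne (Int.fract_eq_zero_iff.2 ⟨_, e.symm⟩)
  rw [Int.le_floor]
  constructor
  · exact ⟨fun hl => by linarith, fun hl => lt_of_le_of_ne (by linarith) fun h0 => by
      apply hne'; rw [h0, sub_self]⟩
  · rw [not_le]
    exact ⟨fun hl => by linarith, fun hl => by linarith⟩

theorem IsTau.of_floor_eq {m : ℕ} {α β : ℝ} {θ : Equiv.Perm (Fin m)} (h : IsTau α θ)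
    (hα : Generic m α) (hβ : Generic m β)
    (hf : ∀ i : ℕ, 1 ≤ i → i ≤ m → ⌊(i : ℝ) * α⌋ = ⌊(i : ℝ) * β⌋) : IsTau β θ := by
  refine isTau_iff.2 ⟨fun i hi hi' =>
    lt_of_le_of_ne (Int.fract_nonneg _) (hβ.2.2 i hi hi').symm, fun i j hi hi' hj hj' => ?_⟩
  rw [← (isTau_iff.1 h).2 i j hi hi' hj hj']
  rcases lt_trichotomy i j with hij | rfl | hij
  · rw [(hα.fract_lt_iff hij hj').1, (hβ.fract_lt_iff hij hj').1, hf i hi hi', hf j hj hj',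
      hf (j - i) (by omega) (by omega)]
  · simp
  · rw [(hα.fract_lt_iff hij hi').2, (hβ.fract_lt_iff hij hi').2, hf i hi hi', hf j hj hj',
      hf (i - j) (by omega) (by omega)]

/-! ### Farey intervals -/

theorem intCast_div_mem_fareySet {m i : ℕ} (hi : 1 ≤ i) (hi' : i ≤ m) {z : ℤ}
    (h0 : (0 : ℚ) ≤ z / i) (h1 : (z / i : ℚ) ≤ 1) : (z / i : ℚ) ∈ fareySet m := by
  refine ⟨h0, h1, ?_⟩
  have h := Rat.den_dvd z i
  rw [Rat.divInt_eq_div, Int.cast_natCast, Int.natCast_dvd_natCast] at h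
  exact (Nat.le_of_dvd hi h).trans hi'

theorem finite_fareySet (m : ℕ) : (fareySet m).Finite := by
  refine ((Set.finite_Icc (0 : ℤ) m).prod (Set.finite_Icc 0 m)).image
    (fun p : ℤ × ℕ => (p.1 / p.2 : ℚ)) |>.subset fun q hq => ?_
  obtain ⟨h0, h1, h2⟩ := hq
  have h3 : q.num ≤ q.den := by
    have := Rat.num_div_den q
    rw [← this, div_le_one (by exact_mod_cast q.den_pos)] at h1
    exact_mod_cast h1
  exact ⟨(q.num, q.den), ⟨⟨Rat.num_nonneg.2 h0, by simp only; omega⟩, ⟨Nat.zero_le _, h2⟩⟩,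
    Rat.num_div_den q⟩

theorem den_mul_eq_num (q : ℚ) : ((q.den : ℝ)) * (q : ℝ) = q.num := by
  have := Rat.den_mul_eq_num q
  exact_mod_cast this

theorem Generic.ne_of_mem_fareySet {m : ℕ} {α : ℝ} (h : Generic m α) {q : ℚ}
    (hq : q ∈ fareySet m) : (q : ℝ) ≠ α := by
  rintro rfl
  refine h.2.2 q.den q.den_pos hq.2.2 (Int.fract_eq_zero_iff.2 ⟨q.num, ?_⟩)
  exact (den_mul_eq_num q).symm

theorem zero_mem_fareySet {m : ℕ} (hm : 1 ≤ m) : (0 : ℚ) ∈ fareySet m :=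
  ⟨le_rfl, zero_le_one, hm⟩

theorem one_mem_fareySet {m : ℕ} (hm : 1 ≤ m) : (1 : ℚ) ∈ fareySet m :=
  ⟨zero_le_one, le_rfl, hm⟩

theorem Generic.exists_fareySucc {m : ℕ} (hm : 1 ≤ m) {α : ℝ} (h : Generic m α) :
    ∃ a b, FareySucc m a b ∧ α ∈ Set.Ioo (a : ℝ) b := by
  obtain ⟨a, ⟨haF, ha⟩, ha'⟩ := Set.exists_max_image {q ∈ fareySet m | (q : ℝ) < α} id
    ((finite_fareySet m).subset (Set.sep_subset _ _))
    ⟨0, zero_mem_fareySet hm, by simpa using h.1⟩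
  obtain ⟨b, ⟨hbF, hb⟩, hb'⟩ := Set.exists_min_image {q ∈ fareySet m | α < (q : ℝ)} id
    ((finite_fareySet m).subset (Set.sep_subset _ _))
    ⟨1, one_mem_fareySet hm, by simpa using h.2.1⟩
  refine ⟨a, b, ⟨haF, hbF, by exact_mod_cast ha.trans hb, fun c hc hab => ?_⟩, ha, hb⟩
  rcases lt_or_gt_of_ne (h.ne_of_mem_fareySet hc) with hlt | hgt
  · exact absurd (ha' c ⟨hc, hlt⟩) (not_le.2 hab.1)
  · exact absurd (hb' c ⟨hc, hgt⟩) (not_le.2 hab.2)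

theorem FareySucc.pos {m : ℕ} {a b : ℚ} (h : FareySucc m a b) {α : ℝ}
    (hα : α ∈ Set.Ioo (a : ℝ) b) : 0 < α :=
  lt_of_le_of_lt (by exact_mod_cast h.1.1) hα.1

theorem FareySucc.lt_one {m : ℕ} {a b : ℚ} (h : FareySucc m a b) {α : ℝ}
    (hα : α ∈ Set.Ioo (a : ℝ) b) : α < 1 :=
  lt_of_lt_of_le hα.2 (by exact_mod_cast h.2.1.2.1)

/-- Otherwise z/i would be a Farey fraction strictly between the successive terms a and b. -/
theorem FareySucc.not_between {m : ℕ} {a b : ℚ} (h : FareySucc m a b) {α β : ℝ}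
    (hα : α ∈ Set.Ioo (a : ℝ) b) (hβ : β ∈ Set.Ioo (a : ℝ) b) {i : ℕ} (hi : 1 ≤ i) (hi' : i ≤ m)
    (z : ℤ) (h1 : i * α ≤ z) (h2 : (z : ℝ) ≤ i * β) : False := by
  have hi0 : (0 : ℝ) < i := by exact_mod_cast hi
  have h3 : (a : ℝ) < ((z / i : ℚ) : ℝ) := by
    push_cast
    exact hα.1.trans_le ((le_div_iff₀ hi0).2 (by linarith))
  have h4 : ((z / i : ℚ) : ℝ) < b := by
    push_cast
    exact ((div_le_iff₀ hi0).2 (by linarith)).trans_lt hβ.2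
  have h3' : a < (z / i : ℚ) := by exact_mod_cast h3
  have h4' : (z / i : ℚ) < b := by exact_mod_cast h4
  exact h.2.2.2 _ (intCast_div_mem_fareySet hi hi' (h.1.1.trans h3'.le)
    (h4'.le.trans h.2.1.2.1)) ⟨h3', h4'⟩

theorem FareySucc.generic {m : ℕ} {a b : ℚ} (h : FareySucc m a b) {α : ℝ}
    (hα : α ∈ Set.Ioo (a : ℝ) b) : Generic m α := by
  refine ⟨h.pos hα, h.lt_one hα, fun i hi hi' hf => ?_⟩
  obtain ⟨z, hz⟩ := Int.fract_eq_zero_iff.1 hf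
  exact h.not_between hα hα hi hi' z hz.ge hz.le

theorem FareySucc.floor_le {m : ℕ} {a b : ℚ} (h : FareySucc m a b) {α β : ℝ}
    (hα : α ∈ Set.Ioo (a : ℝ) b) (hβ : β ∈ Set.Ioo (a : ℝ) b) {i : ℕ} (hi : 1 ≤ i)
    (hi' : i ≤ m) : ⌊(i : ℝ) * α⌋ ≤ ⌊(i : ℝ) * β⌋ := by
  by_contra hlt
  rw [not_le, Int.floor_lt] at hlt
  exact h.not_between hβ hα hi hi' _ hlt.le (Int.floor_le _)

theorem fareyOf_eq_Ioo {m : ℕ} {a b : ℚ} (h : FareySucc m a b) {α : ℝ}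
    (hα : α ∈ Set.Ioo (a : ℝ) b) {θ : Equiv.Perm (Fin m)} (hθ : IsTau α θ) :
    fareyOf m θ = Set.Ioo (a : ℝ) b := by
  ext β
  constructor
  · rintro ⟨h0, h1, hβ⟩
    have hg := hβ.generic h0 h1
    have hf := fun {i : ℕ} (hi : 1 ≤ i) (hi' : i ≤ m) =>
      hθ.floor_eq (h.pos hα) (h.lt_one hα) hβ h0 h1 hi hi'
    constructor
    · have hpos : (0 : ℝ) < a.den := by exact_mod_cast a.den_pos
      refine lt_of_le_of_ne ?_ (hg.ne_of_mem_fareySet h.1)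
      -- The position relative to the endpoint a is encoded in the integer part at i = `a.den` ≤ m,
      -- which α and β share.
      have h2 : a.num ≤ ⌊(a.den : ℝ) * α⌋ := by
        rw [Int.le_floor, ← den_mul_eq_num]
        exact mul_le_mul_of_nonneg_left hα.1.le hpos.le
      rw [hf a.den_pos h.1.2.2, Int.le_floor, ← den_mul_eq_num] at h2
      exact le_of_mul_le_mul_left h2 hpos
    · have hpos : (0 : ℝ) < b.den := by exact_mod_cast b.den_pos
      have h2 : ⌊(b.den : ℝ) * α⌋ < b.num := by
        rw [Int.floor_lt, ← den_mul_eq_num]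
        exact mul_lt_mul_of_pos_left hα.2 hpos
      rw [hf b.den_pos h.2.1.2.2, Int.floor_lt, ← den_mul_eq_num] at h2
      exact lt_of_mul_lt_mul_left h2 hpos.le
  · intro hβ
    exact ⟨h.pos hβ, h.lt_one hβ, hθ.of_floor_eq (h.generic hα) (h.generic hβ) fun i hi hi' =>
      le_antisymm (h.floor_le hα hβ hi hi') (h.floor_le hβ hα hi hi')⟩

theorem exists_fareyOf_eq_Ioo {m : ℕ} (hm : 1 ≤ m) {α : ℝ} {θ : Equiv.Perm (Fin m)}
    (hα : α ∈ fareyOf m θ) :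
    ∃ a b, FareySucc m a b ∧ α ∈ Set.Ioo (a : ℝ) b ∧ fareyOf m θ = Set.Ioo (a : ℝ) b := by
  obtain ⟨a, b, h, hab⟩ := (hα.2.2.generic hα.1 hα.2.1).exists_fareySucc hm
  exact ⟨a, b, h, hab, fareyOf_eq_Ioo h hab hα.2.2⟩

/-! ### Surányi's bijection -/

/-- At the parameter a/(m+1) the fractional parts are exactly π(i)/(m+1). -/
theorem IsTau.of_mul_modEq {m : ℕ} {π : Equiv.Perm (Fin m)} {a : ℤ}
    (h : ∀ i : ℕ, 1 ≤ i → i ≤ m → term π i ≡ i * a [ZMOD (m + 1 : ℕ)]) :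
    IsTau ((a : ℝ) / (m + 1 : ℕ)) π := by
  have hpos : (0 : ℝ) < (m + 1 : ℕ) := by positivity
  have key : ∀ i : ℕ, 1 ≤ i → i ≤ m →
      Int.fract ((i : ℝ) * ((a : ℝ) / (m + 1 : ℕ))) = (term π i : ℝ) / (m + 1 : ℕ) := by
    intro i hi hi'
    have a1 := one_le_term π hi hi'
    have a2 := term_le π hi hi'
    rw [Int.fract_eq_iff]
    refine ⟨div_nonneg (by exact_mod_cast (by omega : 0 ≤ term π i)) hpos.le, ?_, ?_⟩
    · rw [div_lt_one hpos]
      exact_mod_cast (by push_cast; omega : term π i < (m + 1 : ℕ))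
    · obtain ⟨c, hc⟩ := Int.modEq_iff_dvd.1 (h i hi hi')
      refine ⟨c, ?_⟩
      rw [← mul_div_assoc, ← sub_div, div_eq_iff hpos.ne', mul_comm (c : ℝ)]
      exact_mod_cast hc
  refine isTau_iff.2 ⟨fun i hi hi' => ?_, fun i j hi hi' hj hj' => ?_⟩
  · rw [key i hi hi']
    have a1 := one_le_term π hi hi'
    exact div_pos (by exact_mod_cast (by omega : 0 < term π i)) hpos
  · rw [key i hi hi', key j hj hj', div_lt_div_iff_of_pos_right hpos, Int.cast_lt]

/-- An irrational parameter stays generic in degree m+1, so it produces a child of π with a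
parameter in the prescribed subinterval. -/
theorem exists_child {m : ℕ} {π : Equiv.Perm (Fin m)} {x y : ℝ} (hxy : x < y)
    (h : ∀ α, x < α → α < y → α ∈ fareyOf m π) :
    ∃ α, x < α ∧ α < y ∧ ∃ θ : Equiv.Perm (Fin (m + 1)), IsTau α θ ∧ θ ∈ V (m + 1) ∧
      Psi (Gam θ) = π := by
  obtain ⟨α, hα, h1, h2⟩ := exists_irrational_btwn hxy
  obtain ⟨h3, h4, h5⟩ := h α h1 h2
  obtain ⟨θ, hθ⟩ := exists_isTau (Generic.of_irrational (m := m + 1) h3 h4 hα)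
  exact ⟨α, h1, h2, θ, hθ, hθ.mem_V h3 h4, isTau_unique (hθ.Psi_Gam h3 h4) h5⟩

theorem fareyOf_nonempty {m : ℕ} (hm : 1 ≤ m) {θ : Equiv.Perm (Fin m)} (hθ : θ ∈ V m) :
    (fareyOf m θ).Nonempty := by
  induction m, hm using Nat.le_induction with
  | base =>
    obtain ⟨θ', h⟩ := exists_isTau (m := 1) (α := 1 / 2) ⟨by norm_num, by norm_num, fun i hi hi' => by
      obtain rfl : i = 1 := le_antisymm hi' hi
      rw [Nat.cast_one, one_mul, Int.fract_eq_self.2 ⟨by norm_num, by norm_num⟩]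
      norm_num⟩
    exact ⟨1 / 2, by norm_num, by norm_num, Subsingleton.elim θ' θ ▸ h⟩
  | succ m hm ih =>
    have hπ := Psi_Gam_mem_V hm hθ
    obtain ⟨α, hα⟩ := ih hπ
    obtain ⟨a, b, hab, hαI, hF⟩ := exists_fareyOf_eq_Ioo hm hα
    by_cases hs : term (Psi (Gam θ)) 1 + term (Psi (Gam θ)) m = m + 1
    · have hn : (0 : ℝ) < (m + 1 : ℕ) := by positivity
      have c1 := one_le_term (Psi (Gam θ)) (i := 1) le_rfl hm
      have c2 := term_le (Psi (Gam θ)) (i := 1) le_rfl hm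
      -- The point π(1)/(m+1) lies inside the interval of the parent π, leaving room for one child
      -- on each side.
      have hγ : ((term (Psi (Gam θ)) 1 : ℤ) : ℝ) / (m + 1 : ℕ) ∈ fareyOf m (Psi (Gam θ)) :=
        ⟨div_pos (by exact_mod_cast (by omega : 0 < term (Psi (Gam θ)) 1)) hn,
          (div_lt_one hn).2 (by
            exact_mod_cast (by push_cast; omega : term (Psi (Gam θ)) 1 < (m + 1 : ℕ))),
          IsTau.of_mul_modEq fun i hi hi' => term_modEq_of_add_eq hπ hs hi hi'⟩
      have hγ' := hγ
      rw [hF] at hγ'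
      obtain ⟨α₁, h1, h1', θ₁, ht₁, hV₁, e₁⟩ := exists_child (π := Psi (Gam θ)) hγ'.1
        fun β h h' => hF ▸ ⟨h, h'.trans hγ'.2⟩
      obtain ⟨α₂, h2, h2', θ₂, ht₂, hV₂, e₂⟩ := exists_child (π := Psi (Gam θ)) hγ'.2
        fun β h h' => hF ▸ ⟨hγ'.1.trans h, h'⟩
      have p1 : α₁ ∈ Set.Ioo (a : ℝ) b := ⟨h1, h1'.trans hγ'.2⟩
      have p2 : α₂ ∈ Set.Ioo (a : ℝ) b := ⟨hγ'.1.trans h2, h2'⟩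
      -- The two children differ because ⌊(m+1)α⌋ reaches π(1) only to the right of the splitting
      -- point. They therefore exhaust the children of π, and θ is one of them.
      have hne : θ₁ ≠ θ₂ := by
        rintro rfl
        have hf := ht₁.floor_eq (hab.pos p1) (hab.lt_one p1) ht₂ (hab.pos p2) (hab.lt_one p2)
          (i := m + 1) (by omega) le_rfl
        have f1 : ⌊((m + 1 : ℕ) : ℝ) * α₁⌋ < term (Psi (Gam θ₁)) 1 := by
          rw [Int.floor_lt, e₁, mul_comm]
          exact (lt_div_iff₀ hn).1 h1'
        have f2 : term (Psi (Gam θ₁)) 1 ≤ ⌊((m + 1 : ℕ) : ℝ) * α₂⌋ := by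
          rw [Int.le_floor, e₁, mul_comm]
          exact ((div_lt_iff₀ hn).1 h2).le
        omega
      rcases two_children hm hV₁ hV₂ hθ e₁ e₂ hne with rfl | rfl
      · exact ⟨α₁, hab.pos p1, hab.lt_one p1, ht₁⟩
      · exact ⟨α₂, hab.pos p2, hab.lt_one p2, ht₂⟩
    · obtain ⟨α', h1, h1', θ', ht, hV, e⟩ := exists_child (π := Psi (Gam θ))
        (hαI.1.trans hαI.2) fun β h h' => hF ▸ ⟨h, h'⟩
      -- Two different children would force π(1)+π(m) = m+1.
      have : θ = θ' := by
        by_contra hne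
        exact hs (siblings_term_one hm hθ hV e.symm hne).1
      exact ⟨α', hab.pos ⟨h1, h1'⟩, hab.lt_one ⟨h1, h1'⟩, this ▸ ht⟩

theorem bijOn_fareyOf {m : ℕ} (hm : 1 ≤ m) : Set.BijOn (fareyOf m) (V m) (fareyIntervals m) := by
  refine ⟨fun θ hθ => ?_, fun θ hθ θ' _ h => ?_, fun F hF => ?_⟩
  · obtain ⟨α, hα⟩ := fareyOf_nonempty hm hθ
    obtain ⟨a, b, h, -, h'⟩ := exists_fareyOf_eq_Ioo hm hα
    exact ⟨a, b, h, h'⟩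
  · obtain ⟨α, hα⟩ := fareyOf_nonempty hm hθ
    have hα' := hα
    rw [h] at hα'
    exact isTau_unique hα.2.2 hα'.2.2
  · obtain ⟨a, b, h, rfl⟩ := hF
    have hlt : (a : ℝ) < b := by exact_mod_cast h.2.2.1
    obtain ⟨α, hα⟩ := exists_between hlt
    obtain ⟨θ, hθ⟩ := exists_isTau (h.generic hα)
    exact ⟨θ, hθ.mem_V (h.pos hα) (h.lt_one hα), fareyOf_eq_Ioo h hα hθ⟩

/-! ### The order of the Farey intervals -/

theorem FareySucc.right_le_left {m : ℕ} {a b a' b' : ℚ} (h : FareySucc m a b)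
    (h' : FareySucc m a' b') (hlt : a < a') : b ≤ a' :=
  not_lt.1 fun h1 => h.2.2.2 a' h'.1 ⟨hlt, h1⟩

theorem FareySucc.right_unique {m : ℕ} {a b b' : ℚ} (h : FareySucc m a b)
    (h' : FareySucc m a b') : b = b' :=
  le_antisymm (not_lt.1 fun h1 => h.2.2.2 b' h'.2.1 ⟨h'.2.2.1, h1⟩)
    (not_lt.1 fun h1 => h'.2.2.2 b h.2.1 ⟨h.2.2.1, h1⟩)

/-- Two different Farey intervals are ordered like any of their points. -/
theorem fareyLE_iff_lt {m : ℕ} {F F' : Set ℝ} (hF : F ∈ fareyIntervals m)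
    (hF' : F' ∈ fareyIntervals m) (hne : F ≠ F') {α β : ℝ} (hα : α ∈ F) (hβ : β ∈ F') :
    FareyLE m F F' ↔ α < β := by
  constructor
  · rintro ⟨a, b, a', b', h, h', rfl, rfl, hle⟩
    rcases hle.lt_or_eq with hlt | rfl
    · have := h.right_le_left h' hlt
      have : (b : ℝ) ≤ a' := by exact_mod_cast this
      exact hα.2.trans_le (this.trans hβ.1.le)
    · exact absurd (by rw [h.right_unique h']) hne
  · intro hlt
    obtain ⟨a, b, h, rfl⟩ := hF
    obtain ⟨a', b', h', rfl⟩ := hF'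
    refine ⟨a, b, a', b', h, h', rfl, rfl, not_lt.1 fun h1 => ?_⟩
    have : (b' : ℝ) ≤ a := by exact_mod_cast h'.right_le_left h h1
    exact (hβ.2.trans_le (this.trans hα.1.le)).not_gt hlt

theorem fareyIntervals_nonempty {m : ℕ} {F : Set ℝ} (hF : F ∈ fareyIntervals m) :
    F.Nonempty := by
  obtain ⟨a, b, h, rfl⟩ := hF
  exact Set.nonempty_Ioo.2 (by exact_mod_cast h.2.2.1)

theorem fareyLE_refl {m : ℕ} {F : Set ℝ} (hF : F ∈ fareyIntervals m) : FareyLE m F F := by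
  obtain ⟨a, b, h, rfl⟩ := hF
  exact ⟨a, b, a, b, h, h, rfl, rfl, le_rfl⟩

theorem eq_of_mem_fareyIntervals {m : ℕ} {F F' : Set ℝ} (hF : F ∈ fareyIntervals m)
    (hF' : F' ∈ fareyIntervals m) {α : ℝ} (hα : α ∈ F) (hα' : α ∈ F') : F = F' := by
  by_contra hne
  have h1 := mt (fareyLE_iff_lt hF hF' hne hα hα').1 (lt_irrefl α)
  obtain ⟨a, b, h, rfl⟩ := hF
  obtain ⟨a', b', h', rfl⟩ := hF'
  have h2 := mt (fareyLE_iff_lt ⟨a', b', h', rfl⟩ ⟨a, b, h, rfl⟩ (Ne.symm hne) hα' hα).1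
    (lt_irrefl α)
  rcases le_total a a' with hle | hle
  · exact h1 ⟨a, b, a', b', h, h', rfl, rfl, hle⟩
  · exact h2 ⟨a', b', a, b, h', h, rfl, rfl, hle⟩

/-! ### Comparison of the trees -/

theorem fareyOf_subset_Psi_Gam {m : ℕ} (θ : Equiv.Perm (Fin (m + 1))) :
    fareyOf (m + 1) θ ⊆ fareyOf m (Psi (Gam θ)) :=
  fun _ h => ⟨h.1, h.2.1, h.2.2.Psi_Gam h.1 h.2.1⟩

theorem Psi_Gam_eq_iff {m : ℕ} {π : Equiv.Perm (Fin m)} {θ : Equiv.Perm (Fin (m + 1))}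
    (hθ : θ ∈ V (m + 1)) : Psi (Gam θ) = π ↔ fareyOf (m + 1) θ ⊆ fareyOf m π := by
  constructor
  · rintro rfl
    exact fareyOf_subset_Psi_Gam θ
  · intro h
    obtain ⟨α, hα⟩ := fareyOf_nonempty (Nat.le_add_left 1 m) hθ
    exact isTau_unique (fareyOf_subset_Psi_Gam θ hα).2.2 (h hα).2.2

/-- Of two siblings `θ_{a,0}`, `θ_{a,1}`, the first one has the smaller parameters. -/
theorem lt_of_isTheta {m : ℕ} (hm : 1 ≤ m) {θ θ' : Equiv.Perm (Fin (m + 1))} {a : ℤ}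
    (h0 : IsTheta a 0 θ) (h1 : IsTheta a 1 θ') (h : Psi (Gam θ) = Psi (Gam θ')) {α β : ℝ}
    (hα : α ∈ fareyOf (m + 1) θ) (hβ : β ∈ fareyOf (m + 1) θ') : α < β := by
  have e0 := h0.term_last_zero (by omega)
  have e1 := h1.term_last_one (by omega)
  have b0 := term_le θ (i := m) hm (by omega)
  have b1 := one_le_term θ' (i := m) hm (by omega)
  have b2 : term θ' m ≠ term θ' (m + 1) := fun h => by
    have := term_inj θ' hm (by omega) (by omega) le_rfl h
    omega
  -- θ ends in its maximum, so there is no descent at m; θ' ends in its minimum, so there is one.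
  -- The integer parts at m agree because both parameters belong to the common parent.
  have f0 := hα.2.2.floor_succ_mul hα.1 hα.2.1 hm (Nat.lt_succ_self m)
  have f1 := hβ.2.2.floor_succ_mul hβ.1 hβ.2.1 hm (Nat.lt_succ_self m)
  rw [if_neg (by omega)] at f0
  rw [if_pos (by omega)] at f1
  have f := (fareyOf_subset_Psi_Gam θ hα).2.2.floor_eq hα.1 hα.2.1
    (h ▸ (fareyOf_subset_Psi_Gam θ' hβ).2.2) hβ.1 hβ.2.1 hm le_rfl
  have hlt : ⌊((m + 1 : ℕ) : ℝ) * α⌋ < ⌊((m + 1 : ℕ) : ℝ) * β⌋ := by omega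
  have : ((m + 1 : ℕ) : ℝ) * α < ((m + 1 : ℕ) : ℝ) * β :=
    not_le.1 fun hle => (Int.floor_le_floor hle).not_gt hlt
  exact lt_of_mul_lt_mul_left this (by positivity)

theorem fareyOf_mem {m : ℕ} (hm : 1 ≤ m) {θ : Equiv.Perm (Fin m)} (hθ : θ ∈ V m) :
    fareyOf m θ ∈ fareyIntervals m := (bijOn_fareyOf hm).mapsTo hθ

theorem fareyOf_ne {m : ℕ} (hm : 1 ≤ m) {θ θ' : Equiv.Perm (Fin m)} (hθ : θ ∈ V m)
    (hθ' : θ' ∈ V m) (hne : θ ≠ θ') : fareyOf m θ ≠ fareyOf m θ' :=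
  fun h => hne ((bijOn_fareyOf hm).injOn hθ hθ' h)

theorem sib_imp {M m : ℕ} {x y : Equiv.Perm (Fin (m + 1))} (h : (genTree M).sib m x y) :
    (fareyTree M).sib m (fareyOf (m + 1) x) (fareyOf (m + 1) y) := by
  have hM : 1 ≤ M := by have := h.1; omega
  have hne := ((isBinaryTree_genTree hM).sib_edge m x y h).1
  obtain ⟨hm, hx, hy, hp, he, a, -, -, h0, h1⟩ := h
  obtain ⟨α, hα⟩ := fareyOf_nonempty (Nat.le_add_left 1 m) hx
  obtain ⟨β, hβ⟩ := fareyOf_nonempty (Nat.le_add_left 1 m) hy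
  have hn := fareyOf_ne (Nat.le_add_left 1 m) hx hy hne
  exact ⟨hm, hn, (fareyLE_iff_lt (fareyOf_mem (by omega) hx) (fareyOf_mem (by omega) hy) hn hα
    hβ).2 (lt_of_isTheta hm.1 h0 h1 he hα hβ), _, fareyOf_mem hm.1 hp, fareyOf_subset_Psi_Gam x,
    he ▸ fareyOf_subset_Psi_Gam y⟩

theorem not_fareyLE_symm {m : ℕ} {F F' : Set ℝ} (hF : F ∈ fareyIntervals m)
    (hF' : F' ∈ fareyIntervals m) (hne : F ≠ F') (h : FareyLE m F F') : ¬ FareyLE m F' F := by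
  intro h'
  obtain ⟨α, hα⟩ := fareyIntervals_nonempty hF
  obtain ⟨β, hβ⟩ := fareyIntervals_nonempty hF'
  exact lt_asymm ((fareyLE_iff_lt hF hF' hne hα hβ).1 h)
    ((fareyLE_iff_lt hF' hF hne.symm hβ hα).1 h')

theorem fareyLE_total {m : ℕ} {F F' : Set ℝ} (hF : F ∈ fareyIntervals m)
    (hF' : F' ∈ fareyIntervals m) : FareyLE m F F' ∨ FareyLE m F' F := by
  obtain ⟨a, b, h, rfl⟩ := hF
  obtain ⟨a', b', h', rfl⟩ := hF'
  exact (le_total a a').imp (fun hle => ⟨a, b, a', b', h, h', rfl, rfl, hle⟩)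
    (fun hle => ⟨a', b', a, b, h', h, rfl, rfl, hle⟩)

theorem isIso_fareyOf {M : ℕ} (hM : 1 ≤ M) :
    (genTree M).IsIso (fareyTree M) fareyOf where
  bij m := by
    by_cases h : 1 ≤ m ∧ m ≤ M
    · have e1 : (genTree M).node m = V m := by
        ext θ; exact ⟨fun h => h.2.2, fun hθ => ⟨h.1, h.2, hθ⟩⟩
      have e2 : (fareyTree M).node m = fareyIntervals m := by
        ext θ; exact ⟨fun h => h.2.2, fun hθ => ⟨h.1, h.2, hθ⟩⟩
      rw [e1, e2]
      exact bijOn_fareyOf h.1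
    · have e1 : (genTree M).node m = ∅ :=
        Set.eq_empty_of_forall_notMem fun θ hθ => h ⟨hθ.1, hθ.2.1⟩
      have e2 : (fareyTree M).node m = ∅ :=
        Set.eq_empty_of_forall_notMem fun F hF => h ⟨hF.1, hF.2.1⟩
      rw [e1, e2]
      exact Set.bijOn_empty _
  edge_iff m p hp x hx := by
    constructor
    · rintro ⟨hm, -, -, he⟩
      exact ⟨hm, fareyOf_mem hm.1 hp.2.2, fareyOf_mem hx.1 hx.2.2,
        (Psi_Gam_eq_iff hx.2.2).1 he⟩
    · rintro ⟨hm, -, -, he⟩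
      exact ⟨hm, hp.2.2, hx.2.2, (Psi_Gam_eq_iff hx.2.2).2 he⟩
  sib_iff m x hx y hy := by
    refine ⟨sib_imp, fun h => ?_⟩
    obtain ⟨hm, hne, hle, F, hF, hxF, hyF⟩ := h
    obtain ⟨π, hπ, rfl⟩ := (bijOn_fareyOf hm.1).surjOn hF
    have ex : (genTree M).edge m π x := ⟨hm, hπ, hx.2.2, (Psi_Gam_eq_iff hx.2.2).2 hxF⟩
    have ey : (genTree M).edge m π y := ⟨hm, hπ, hy.2.2, (Psi_Gam_eq_iff hy.2.2).2 hyF⟩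
    -- Reflection follows from preservation: siblings are comparable, and the opposite order would
    -- be carried to the opposite order of the Farey intervals.
    rcases (isBinaryTree_genTree hM).sib_total m π x y ex ey (fun h => hne (by rw [h])) with
      h | h
    · exact h.1
    · exact absurd (sib_imp h.1).2.2.1 (not_fareyLE_symm (fareyOf_mem hx.1 hx.2.2)
        (fareyOf_mem hy.1 hy.2.2) hne hle)

/-- Uniqueness of the parent is disjointness of Farey intervals. The root, the existence of a parent
and the bound of two children are carried over from the generation tree by `fareyOf`. -/
theorem isBinaryTree_fareyTree {M : ℕ} (hM : 1 ≤ M) : (fareyTree M).IsBinaryTree M where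
  level _ _ h := ⟨h.1, h.2.1⟩
  root := by
    obtain ⟨r, hr⟩ := (isBinaryTree_genTree hM).root
    refine ⟨fareyOf 1 r, ?_⟩
    rw [← ((isIso_fareyOf hM).bij 1).image_eq, hr, Set.image_singleton]
  edge_mem m p x h := ⟨⟨h.1.1, (Nat.le_succ m).trans h.1.2, h.2.1⟩,
    ⟨Nat.le_add_left 1 m, h.1.2, h.2.2.1⟩⟩
  parent m hm x hx := by
    obtain ⟨θ, hθ, rfl⟩ := (bijOn_fareyOf (Nat.le_add_left 1 m)).surjOn hx.2.2
    refine ⟨fareyOf m (Psi (Gam θ)), ⟨⟨hm, hx.2.1⟩, fareyOf_mem hm (Psi_Gam_mem_V hm hθ),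
      hx.2.2, fareyOf_subset_Psi_Gam θ⟩, fun F hF => ?_⟩
    obtain ⟨α, hα⟩ := fareyIntervals_nonempty hx.2.2
    exact eq_of_mem_fareyIntervals hF.2.1 (fareyOf_mem hm (Psi_Gam_mem_V hm hθ))
      (hF.2.2.2 hα) (fareyOf_subset_Psi_Gam θ hα)
  children m F := by
    by_cases h : ∃ x, (fareyTree M).edge m F x
    · obtain ⟨x, hm, hF, -⟩ := h
      obtain ⟨π, hπ, rfl⟩ := (bijOn_fareyOf hm.1).surjOn hF
      refine (Set.encard_le_encard (t := fareyOf (m + 1) '' {θ | (genTree M).edge m π θ}) ?_).trans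
        ((Set.encard_image_le _ _).trans ((isBinaryTree_genTree hM).children m π))
      intro y hy
      obtain ⟨θ, hθ, rfl⟩ := (bijOn_fareyOf (Nat.le_add_left 1 m)).surjOn hy.2.2.1
      exact ⟨θ, ⟨hm, hπ, hθ, (Psi_Gam_eq_iff hθ).2 hy.2.2.2⟩, rfl⟩
    · push Not at h
      rw [Set.eq_empty_of_forall_notMem (s := {x | (fareyTree M).edge m F x}) h]
      simp
  sib_edge m x y h := by
    obtain ⟨hm, hne, hle, F, hF, hxF, hyF⟩ := h
    obtain ⟨a, b, a', b', h, h', hx, hy, -⟩ := hle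
    exact ⟨hne, F, ⟨hm, hF, ⟨a, b, h, hx⟩, hxF⟩, ⟨hm, hF, ⟨a', b', h', hy⟩, hyF⟩⟩
  sib_total m p x y hx hy hne := by
    have hF := hx.2.2.1
    have hF' := hy.2.2.1
    rcases fareyLE_total hF hF' with h | h
    · exact Or.inl ⟨⟨hx.1, hne, h, p, hx.2.1, hx.2.2.2, hy.2.2.2⟩,
        fun h' => not_fareyLE_symm hF hF' hne h h'.2.2.1⟩
    · exact Or.inr ⟨⟨hx.1, hne.symm, h, p, hx.2.1, hy.2.2.2, hx.2.2.2⟩,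
        fun h' => not_fareyLE_symm hF' hF hne.symm h h'.2.2.1⟩

/-- An isomorphism says nothing about pairs outside the nodes. Equality of the relations needs in
addition that edges and sibling pairs join nodes only, which is what the two binary tree hypotheses
supply. -/
theorem LevelTree.IsIso.eq_map {α β : ℕ → Type} {M : ℕ} {T : LevelTree α} {T' : LevelTree β}
    {e : ∀ m, α m → β m} (h : T.IsIso T' e) (hT : T.IsBinaryTree M) (hT' : T'.IsBinaryTree M)
    {φ : ∀ m, β m → α m} (hφ : ∀ m, ∀ x ∈ T.node m, φ m (e m x) = x) : T = T'.map φ := by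
  have hsurj : ∀ m, ∀ y ∈ T'.node m, ∃ x ∈ T.node m, e m x = y := fun m => (h.bij m).surjOn
  have hnode : T.node = (T'.map φ).node := by
    funext m
    ext x
    constructor
    · exact fun hx => ⟨e m x, (h.bij m).mapsTo hx, hφ m x hx⟩
    · rintro ⟨y, hy, rfl⟩
      obtain ⟨x, hx, rfl⟩ := hsurj m y hy
      rwa [hφ m x hx]
  have hedge : T.edge = (T'.map φ).edge := by
    funext m p x
    refine propext ⟨fun hpx => ?_, ?_⟩
    · obtain ⟨hp, hx⟩ := hT.edge_mem m p x hpx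
      exact ⟨e m p, e (m + 1) x, (h.edge_iff m p hp x hx).1 hpx, hφ m p hp, hφ _ x hx⟩
    · rintro ⟨p', x', hpx, rfl, rfl⟩
      obtain ⟨hp, hx⟩ := hT'.edge_mem m p' x' hpx
      obtain ⟨p, hp', rfl⟩ := hsurj m p' hp
      obtain ⟨x, hx', rfl⟩ := hsurj _ x' hx
      rw [hφ m p hp', hφ _ x hx']
      exact (h.edge_iff m p hp' x hx').2 hpx
  have hsib : T.sib = (T'.map φ).sib := by
    funext m x y
    refine propext ⟨fun hxy => ?_, ?_⟩
    · obtain ⟨-, p, hpx, hpy⟩ := hT.sib_edge m x y hxy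
      have hx := (hT.edge_mem m p x hpx).2
      have hy := (hT.edge_mem m p y hpy).2
      exact ⟨e _ x, e _ y, (h.sib_iff m x hx y hy).1 hxy, hφ _ x hx, hφ _ y hy⟩
    · rintro ⟨x', y', hxy, rfl, rfl⟩
      obtain ⟨-, p, hpx, hpy⟩ := hT'.sib_edge m x' y' hxy
      obtain ⟨x, hx, rfl⟩ := hsurj _ x' (hT'.edge_mem m p x' hpx).2
      obtain ⟨y, hy, rfl⟩ := hsurj _ y' (hT'.edge_mem m p y' hpy).2
      rw [hφ _ x hx, hφ _ y hy]
      exact (h.sib_iff m x hx y hy).2 hxy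
  obtain ⟨_, _, _⟩ := T
  simp only at hnode hedge hsib
  subst hnode hedge hsib
  rfl

theorem genTree_eq_suranyiTree {M : ℕ} (hM : 1 ≤ M) : genTree M = suranyiTree M :=
  (isIso_fareyOf hM).eq_map (isBinaryTree_genTree hM) (isBinaryTree_fareyTree hM)
    fun _ _ hx => (bijOn_fareyOf hx.1).injOn.leftInvOn_invFunOn hx.2.2

/-- The strict horizontal order in the generation tree. -/
theorem left_genTree_iff {M : ℕ} (hM : 1 ≤ M) {m : ℕ} (hm : 1 ≤ m) (hmM : m ≤ M)
    {x y : Equiv.Perm (Fin m)} (hx : x ∈ V m) (hy : y ∈ V m) :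
    (genTree M).Left m x y ↔ x ≠ y ∧ FareyLE m (fareyOf m x) (fareyOf m y) := by
  induction m, hm using Nat.le_induction with
  | base =>
    constructor
    · rintro (⟨⟨h, -⟩, -⟩ | ⟨_, _, ⟨⟨h, -⟩, -⟩, -⟩) <;> exact absurd h (Nat.not_succ_le_zero 0)
    · rintro ⟨hne, -⟩
      exact absurd (Subsingleton.elim x y) hne
  | succ m hm ih =>
    have hpx := Psi_Gam_mem_V hm hx
    have hpy := Psi_Gam_mem_V hm hy
    have ex : (genTree M).edge m (Psi (Gam x)) x := ⟨⟨hm, hmM⟩, hpx, hx, rfl⟩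
    have ey : (genTree M).edge m (Psi (Gam y)) y := ⟨⟨hm, hmM⟩, hpy, hy, rfl⟩
    have hm' : 1 ≤ m + 1 := Nat.le_add_left 1 m
    have hL : (genTree M).Left (m + 1) x y ↔
        (genTree M).sib m x y ∨ (genTree M).Left m (Psi (Gam x)) (Psi (Gam y)) := by
      refine or_congr_right ⟨?_, fun h => ⟨_, _, ex, ey, h⟩⟩
      rintro ⟨p, q, ⟨-, -, -, rfl⟩, ⟨-, -, -, rfl⟩, h⟩
      exact h
    rw [hL, ih (by omega) hpx hpy]
    by_cases hp : Psi (Gam x) = Psi (Gam y)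
    · rw [(isIso_fareyOf hM).sib_iff m x ⟨hm', hmM, hx⟩ y ⟨hm', hmM, hy⟩]
      constructor
      · rintro (h | h)
        · exact ⟨fun e => h.2.1 (by rw [e]), h.2.2.1⟩
        · exact absurd hp h.1
      · rintro ⟨hne, hle⟩
        exact Or.inl ⟨⟨hm, hmM⟩, fareyOf_ne hm' hx hy hne, hle, _, fareyOf_mem hm hpx,
          fareyOf_subset_Psi_Gam x, hp ▸ fareyOf_subset_Psi_Gam y⟩
    · have hne : x ≠ y := fun e => hp (by rw [e])
      obtain ⟨α, hα⟩ := fareyOf_nonempty hm' hx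
      obtain ⟨β, hβ⟩ := fareyOf_nonempty hm' hy
      -- With different parents, the same points α and β decide the order at both levels, since each
      -- lies in the interval of the child and of its parent.
      rw [fareyLE_iff_lt (fareyOf_mem hm' hx) (fareyOf_mem hm' hy) (fareyOf_ne hm' hx hy hne)
        hα hβ, fareyLE_iff_lt (fareyOf_mem hm hpx) (fareyOf_mem hm hpy)
        (fareyOf_ne hm hpx hpy hp) (fareyOf_subset_Psi_Gam x hα) (fareyOf_subset_Psi_Gam y hβ)]
      constructor
      · rintro (h | h)
        · exact absurd h.2.2.2.2.1 hp
        · exact ⟨hne, h.2⟩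
      · exact fun h => Or.inr ⟨hp, h.2⟩

theorem eq_or_left_genTree_iff {M : ℕ} (hM : 1 ≤ M) {m : ℕ} (hm : 1 ≤ m) (hmM : m ≤ M)
    {x y : Equiv.Perm (Fin m)} (hx : x ∈ V m) (hy : y ∈ V m) :
    (x = y ∨ (genTree M).Left m x y) ↔ FareyLE m (fareyOf m x) (fareyOf m y) := by
  rw [left_genTree_iff hM hm hmM hx hy]
  constructor
  · rintro (rfl | h)
    · exact fareyLE_refl (fareyOf_mem hm hx)
    · exact h.2
  · exact fun h => (em (x = y)).imp_right fun hne => ⟨hne, h⟩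

end SosTree

theorem mainTheorem6 (M : ℕ) (hM : 1 ≤ M) :
    -- both trees are binary trees with levels `1, …, M`
    (SosTree.genTree M).IsBinaryTree M ∧
    (SosTree.fareyTree M).IsBinaryTree M ∧
    -- the generation tree is identical with the tree obtained through the bijection
    SosTree.genTree M = SosTree.suranyiTree M ∧
    -- the bijections `𝖥_m : 𝒱_m → 𝔉_m` form an isomorphism with the Farey interval tree
    (SosTree.genTree M).IsIso (SosTree.fareyTree M) SosTree.fareyOf ∧
    -- in each level, the horizontal order is the order of the corresponding Farey intervals
    (∀ m ∈ Finset.Icc 1 M, ∀ θ ∈ SosTree.V m, ∀ θ' ∈ SosTree.V m,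
      ((θ = θ' ∨ (SosTree.genTree M).Left m θ θ') ↔
        SosTree.FareyLE m (SosTree.fareyOf m θ) (SosTree.fareyOf m θ'))) :=
  ⟨SosTree.isBinaryTree_genTree hM, SosTree.isBinaryTree_fareyTree hM,
    SosTree.genTree_eq_suranyiTree hM, SosTree.isIso_fareyOf hM, fun _ hm _ hθ _ hθ' =>
      SosTree.eq_or_left_genTree_iff hM (Finset.mem_Icc.1 hm).1 (Finset.mem_Icc.1 hm).2 hθ hθ'⟩
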